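/- **Setting.** There are $n\ge 2$ agents and a space $\Omega$ of solutions. The principal has a measurable utility $x:\Omega\to\mathbb R_{>0}$ and agent $i$ a utility $y_i:\Omega\to\mathbb R_{>0}$. The agents are symmetric: each finds $k\ge 2$ solutions, and all solutions $\omega_{i,j}$ ($i\le n$, $j\le k$) are independent draws from one probability law $P$ on $\Omega$. Let $D$ be the law of $X_{i,j}=x(\omega_{i,j})$, and let $D_{\max}$ be the law of $\max_{j\le k}X_{i,j}$. A mechanism turns the agents' signals (and random bits) into a winner, which is a solution found by some agent, or into no winner. If agent $i$'s solution $\omega$ wins, the principal gets $x(\omega)$, agent $i$ gets $y_i(\omega)$ and the other agents get $0$; without a winner everyone gets $0$. Under complete information all agents see all solutions before they choose their (possibly mixed) signals. A mechanism has additive price of anarchy at most $\gamma$ if, for every strategy profile that is a Nash equilibrium at every realization of the solutions, $$\mathbb E\big[\max_{i,j}X_{i,j}\big]\le \mathbb E[\text{principal's utility}]+\gamma .$$ A mechanism is prior-independent if it does not depend on the law of the solutions. The law $D$ has a monotone hazard rate (MHR) if it has a density $f$ such that $f/(1-F)$ is nondecreasing on $\{F<1\}$, where $F$ is the c.d.f.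 of $D$. **Theorem.** Let $n\ge2$, $\Omega$ and $x$ be given. There is a prior-independent mechanism, the same for all $k\ge 2$, all $P$ and all $y_1,\dots,y_n$, with the following properties. It is the multi-agent single-proposal mechanism without eligibility restrictions: each agent proposes at most one of his solutions, and the principal adopts a proposal that maximizes $x$, ties being broken by a fixed ranking of the agents. 1. If $D$ has MHR, then $D_{\max}$ has finite variance and the mechanism has additive price of anarchy at most $\sqrt{\tfrac43\operatorname{Var}(D_{\max})}$. 2. If $D=U[0,1]$, then $$\sqrt{\tfrac43\operatorname{Var}(D_{\max})}=\sqrt{\frac{4k}{3(k+1)^2(k+2)}},$$ and the mechanism has additive price of anarchy at most this number. For every $k\ge2$ the number in 2 is at most $1.155/k$. It is asymptotically $\frac{2}{\sqrt3}\cdot\frac1k$, i.e. $k$ times it tends to $2/\sqrt3$ as $k\to\infty$, and $|2/\sqrt3-1.155|<0.0005$. -/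

import Mathlib

open MeasureTheory ProbabilityTheory Filter Topology
open scoped ENNReal

universe u

namespace Delegation

/-- The outcome of a delegation mechanism: a winning solution together with the agent who owns it,
or `none`, the null outcome (no solution is adopted). -/
abbrev Outcome (n : ℕ) (Ω : Type u) : Type u := Option (Fin n × Ω)

/-- A delegation mechanism for `n` agents with solution space `Ω`: signal spaces, the signals that an
agent can send when holding a given multiset of solutions, random bits with their law, and an
allocation rule. The winner is always a solution that its owner has really found. -/
structure Mechanism (n : ℕ) (Ω : Type u) where
  Signal : Fin n → Type u
  feasible : (i : Fin n) → Multiset Ω → Set (Signal i)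
  Bits : Type
  bitsLaw : PMF Bits
  alloc : ((i : Fin n) → Signal i) → Bits → Outcome n Ω
  winner_mem : ∀ (held : Fin n → Multiset Ω) (a : (i : Fin n) → Signal i) (b : Bits)
    (j : Fin n) (w : Ω), (∀ i, a i ∈ feasible i (held i)) → alloc a b = some (j, w) → w ∈ held j

/-- The principal's utility of an outcome. -/
def principalValue {n : ℕ} {Ω : Type u} (x : Ω → ℝ) : Outcome n Ω → ℝ
  | none => 0
  | some p => x p.2

/-- Agent `i`'s utility of an outcome: zero unless `i` owns the winner. -/
def agentValue {n : ℕ} {Ω : Type u} (y : Fin n → Ω → ℝ) (i : Fin n) : Outcome n Ω → ℝ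
  | none => 0
  | some p => if p.1 = i then y i p.2 else 0

/-- The multiset of solutions found by agent `i` in the realization `ω`. -/
def held {n k : ℕ} {Ω : Type u} (ω : Fin n → Fin k → Ω) (i : Fin n) : Multiset Ω :=
  Finset.univ.val.map (ω i)

namespace Mechanism

variable {n : ℕ} {Ω : Type u}

/-- Expected value of a nonnegative function `g` of the outcome when the agents independently
play the mixed signals `s` (expectation also over the random bits). -/
noncomputable def expect (M : Mechanism n Ω) (g : Outcome n Ω → ℝ)
    (s : (i : Fin n) → PMF (M.Signal i)) : ℝ≥0∞ :=
  ∑' a : (i : Fin n) → M.Signal i,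
    (∏ i, s i (a i)) * ∑' b : M.Bits, M.bitsLaw b * ENNReal.ofReal (g (M.alloc a b))

/-- `s` is a (possibly mixed) Nash equilibrium of the game that the agents play under complete
information once the solutions `ω` have been found. -/
def IsNash (M : Mechanism n Ω) (y : Fin n → Ω → ℝ) {k : ℕ} (ω : Fin n → Fin k → Ω)
    (s : (i : Fin n) → PMF (M.Signal i)) : Prop :=
  (∀ i, (s i).support ⊆ M.feasible i (held ω i)) ∧
  ∀ (i : Fin n) (t : PMF (M.Signal i)), t.support ⊆ M.feasible i (held ω i) →
    M.expect (agentValue y i) (Function.update s i t) ≤ M.expect (agentValue y i) s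

end Mechanism

section SingleProposal

variable {n : ℕ} {Ω : Type u}

/-- `p = (i, w)` is a candidate: agent `i` proposes `w`, and `w` is eligible for `i`. -/
def IsCandidate (R : Fin n → Set Ω) (a : Fin n → Option Ω) (p : Fin n × Ω) : Prop :=
  a p.1 = some p.2 ∧ p.2 ∈ R p.1

/-- `p` is the candidate selected: it is at least as good for the principal as every other
candidate, and ties are broken in favour of the agent with the smaller rank. -/
def IsSelected (x : Ω → ℝ) (R : Fin n → Set Ω) (rank : Equiv.Perm (Fin n))
    (a : Fin n → Option Ω) (p : Fin n × Ω) : Prop :=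
  IsCandidate R a p ∧ ∀ q, IsCandidate R a q → q.1 ≠ p.1 →
    x q.2 < x p.2 ∨ (x q.2 = x p.2 ∧ rank p.1 < rank q.1)

open Classical in
/-- The multi-agent single-proposal mechanism with eligible sets `R i` and the deterministic
tie-breaking rule given by a ranking of the agents. Each agent proposes at most one
of the solutions found. -/
noncomputable def singleProposal (x : Ω → ℝ) (R : Fin n → Set Ω) (rank : Equiv.Perm (Fin n)) :
    Mechanism n Ω where
  Signal := fun _ => Option Ω
  feasible := fun _ m => {s | ∀ w, s = some w → w ∈ m}
  Bits := Unit
  bitsLaw := PMF.pure ()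
  alloc := fun a _ => if h : ∃ p, IsSelected x R rank a p then some h.choose else none
  winner_mem := by
    intro held a b j w hfeas hw
    split_ifs at hw with h
    have hp := h.choose_spec.1.1
    rw [Option.some.injEq] at hw
    rw [hw] at hp
    exact hfeas j w hp

end SingleProposal

section Symmetric

variable {n : ℕ} {Ω : Type u} [MeasurableSpace Ω]

/-- The law of all solutions under symmetric agents: each of the `n` agents draws `k` solutions,
all draws being independent with law `P`. -/
noncomputable def solutionLaw (n k : ℕ) (P : Measure Ω) : Measure (Fin n → Fin k → Ω) :=
  Measure.pi fun _ => Measure.pi fun _ => P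

/-- The law of the principal's utility of an agent's best solution among `k` independent draws. -/
noncomputable def bestLaw (x : Ω → ℝ) (k : ℕ) (P : Measure Ω) : Measure ℝ :=
  (Measure.pi fun _ : Fin k => P).map fun w => ⨆ j, x (w j)

/-- The benchmark: the expected maximum of the principal's utility over all solutions found. -/
noncomputable def opt (n : ℕ) (x : Ω → ℝ) (k : ℕ) (P : Measure Ω) : ℝ≥0∞ :=
  ∫⁻ ω, ENNReal.ofReal (⨆ i, ⨆ j, x (ω i j)) ∂(solutionLaw n k P)

/-- Complete information, symmetric agents: `M` has additive price of anarchy at most `γ`, i.e.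
`opt ≤ E[principal's utility] + γ` for every strategy profile `σ` (a profile of mixed signals for
each realization of all solutions) that is a Nash equilibrium. No measurability of `σ` is required:
the integral on the right is a lower integral, and is the expectation when that makes sense. -/
def Mechanism.HasAdditivePoA (M : Mechanism n Ω) (x : Ω → ℝ) (y : Fin n → Ω → ℝ) (k : ℕ)
    (P : Measure Ω) (γ : ℝ) : Prop :=
  ∀ σ : (Fin n → Fin k → Ω) → (i : Fin n) → PMF (M.Signal i),
    (∀ ω, M.IsNash y ω (σ ω)) →
    opt n x k P ≤
      (∫⁻ ω, M.expect (principalValue x) (σ ω) ∂(solutionLaw n k P)) + ENNReal.ofReal γ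

end Symmetric

/-- `D` has a monotone hazard rate: it has a density `f` such that `f / (1 - F)` is nondecreasing
wherever it is defined, `F` being the c.d.f. of `D`. -/
def HasMHR (D : Measure ℝ) : Prop :=
  ∃ f : ℝ → ℝ, Measurable f ∧ (∀ t, 0 ≤ f t) ∧
    D = volume.withDensity (fun t => ENNReal.ofReal (f t)) ∧
    MonotoneOn (fun t => f t / (1 - cdf D t)) {t | cdf D t < 1}

end Delegation

/-! Fix a realization and an equilibrium, and order proposals by strength: value for the principal,
then rank. Of two agents, take the one whose weakest proposal in the support is the weaker. That
proposal never wins against the other agent, so his equilibrium utility is zero. Since `y` is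
positive, no deviation to a solution of his own can ever win, so the principal always gets at least
the best value he has found. Hence the principal's expected utility is at least the smaller of any
two agents' best values (`min_le_expect_principalValue`), and the loss is at most the gap between
the largest and second largest of `n` independent draws from `ν = D_max`. With `F` the c.d.f. of
`ν`, the mean gap is `∫ n F^(n-1) (1 - F)` (`hasAdditivePoA_singleProposal`).

A monotone hazard rate passes from `D` to `ν` (`HasMHR.of_cdf_eq_pow`) and makes `n = 2` the worst
case (`integral_gap_le_of_hasMHR`). Put `θ(v) = n v^(n-1) - 2v`, whose integral over `[0,1]`
vanishes and which changes sign once, from minus to plus. A density `g` of `ν` crosses a multiple `c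
(1 - F)` from below at the same point, so `c ∫ θ(F) (1 - F) ≤ ∫ θ(F) g = 0`.

The gap of two draws is the Gini mean difference `2 Cov(X, 2F(X) - 1)`. As `2F(X) - 1` is uniform on
`[-1,1]`, with variance `1/3`, Cauchy–Schwarz bounds it by `2/√3` standard deviations
(`integral_gini_le_sqrt_variance`). For `U[0,1]` the variance is computed from the moments of `ν`.
-/

namespace Delegation

/-! ### Equilibria of the single-proposal mechanism at a fixed realization. -/

section Game

variable {n : ℕ} {Ω : Type u}

/-- The strength of the proposal `c` of agent `i`: its value for the principal, then the rank. -/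
def strength (x : Ω → ℝ) (rank : Equiv.Perm (Fin n)) (i : Fin n) (c : Option Ω) :
    WithBot (ℝ ×ₗ (Fin n)ᵒᵈ) :=
  -- `⊥` makes abstaining weaker than every proposal; the order dual makes a smaller rank stronger.
  c.elim ⊥ fun w => ((toLex (x w, OrderDual.toDual (rank i)) : ℝ ×ₗ (Fin n)ᵒᵈ) :
    WithBot (ℝ ×ₗ (Fin n)ᵒᵈ))

theorem strength_some_le_iff (x : Ω → ℝ) (rank : Equiv.Perm (Fin n)) (i j : Fin n) (w v : Ω) :
    strength x rank i (some w) ≤ strength x rank j (some v) ↔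
      x w < x v ∨ (x w = x v ∧ rank j ≤ rank i) := by
  simp [strength, Prod.Lex.toLex_le_toLex]

theorem le_of_strength_le {x : Ω → ℝ} {rank : Equiv.Perm (Fin n)} {i j : Fin n} {w v : Ω}
    (h : strength x rank i (some w) ≤ strength x rank j (some v)) : x w ≤ x v := by
  rw [strength_some_le_iff] at h
  rcases h with h | h
  · exact h.le
  · exact h.1.le

theorem exists_isSelected (x : Ω → ℝ) (rank : Equiv.Perm (Fin n)) (a : Fin n → Option Ω)
    {i : Fin n} {w : Ω} (hi : a i = some w) :
    ∃ p, IsSelected x (fun _ => Set.univ) rank a p := by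
  obtain ⟨m, -, hm⟩ := Finset.exists_max_image Finset.univ (fun j => strength x rank j (a j))
    ⟨i, Finset.mem_univ i⟩
  have hmi := hm i (Finset.mem_univ i)
  cases hv : a m with
  | none => rw [hi, hv] at hmi; simp [strength] at hmi
  | some v =>
    refine ⟨(m, v), ⟨hv, Set.mem_univ _⟩, fun q hq hne => ?_⟩
    have hq' := hm q.1 (Finset.mem_univ _)
    rw [hq.1, hv, strength_some_le_iff] at hq'
    rcases hq' with h | ⟨h, h'⟩
    · exact Or.inl h
    · exact Or.inr ⟨h, lt_of_le_of_ne h' fun h => hne (rank.injective h).symm⟩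

/-- Describes the winner as the strongest proposal, so that the choice in the definition of `alloc`
need not be unfolded when somebody proposes. -/
theorem singleProposal_alloc_spec (x : Ω → ℝ) (rank : Equiv.Perm (Fin n)) (a : Fin n → Option Ω)
    {i : Fin n} {w : Ω} (hi : a i = some w) :
    ∃ p, (singleProposal x (fun _ => Set.univ) rank).alloc a () = some p ∧ a p.1 = some p.2 ∧
      ∀ j, strength x rank j (a j) ≤ strength x rank p.1 (some p.2) := by
  classical
  have h := exists_isSelected x rank a hi
  refine ⟨h.choose, dif_pos h, h.choose_spec.1.1, fun j => ?_⟩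
  cases hj : a j with
  | none => simp [strength]
  | some v =>
    rw [strength_some_le_iff]
    by_cases hjp : j = h.choose.1
    · have := h.choose_spec.1.1
      rw [← hjp, hj, Option.some.injEq] at this
      exact Or.inr ⟨by rw [this], by rw [hjp]⟩
    · rcases h.choose_spec.2 (j, v) ⟨hj, Set.mem_univ _⟩ hjp with h | h
      · exact Or.inl h
      · exact Or.inr ⟨h.1, h.2.le⟩

/-- A weak inequality suffices: since ranks are distinct, two agents have equal strength only if
both abstain, and an abstaining agent never wins. -/
theorem agentValue_alloc_eq_zero (x : Ω → ℝ) (rank : Equiv.Perm (Fin n)) (y : Fin n → Ω → ℝ)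
    (a : Fin n → Option Ω) {i j : Fin n} (hij : i ≠ j)
    (h : strength x rank i (a i) ≤ strength x rank j (a j)) :
    agentValue y i ((singleProposal x (fun _ => Set.univ) rank).alloc a ()) = 0 := by
  cases hp : (singleProposal x (fun _ => Set.univ) rank).alloc a () with
  | none => rfl
  | some p =>
    simp only [agentValue, ite_eq_right_iff]
    intro hpi
    exfalso
    by_cases hex : ∃ m w, a m = some w
    · obtain ⟨m, w, hm⟩ := hex
      obtain ⟨q, hq, hq2, hq3⟩ := singleProposal_alloc_spec x rank a hm
      rw [hp, Option.some.injEq] at hq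
      subst hq
      have h3 := hq3 j
      rw [hpi] at hq2 h3
      rw [hq2] at h
      cases hj : a j with
      | none => rw [hj] at h; simp [strength] at h
      | some v =>
        rw [hj, strength_some_le_iff] at h h3
        have : rank i = rank j := by
          rcases h with h | h <;> rcases h3 with h3 | h3
          · exact absurd h h3.not_gt
          · exact absurd h3.1 h.ne'
          · exact absurd h.1 h3.ne'
          · exact le_antisymm h3.2 h.2
        exact hij (rank.injective this)
    · push Not at hex
      have hall : ∀ m, a m = none := fun m => Option.eq_none_iff_forall_ne_some.2 (hex m)
      have : ¬ ∃ p, IsSelected x (fun _ => Set.univ) rank a p := by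
        rintro ⟨p, hp⟩
        have := hp.1.1
        simp [hall] at this
      have h0 : (singleProposal x (fun _ => Set.univ) rank).alloc a () = none := dif_neg this
      rw [h0] at hp
      cases hp

theorem mem_held {k : ℕ} {ω : Fin n → Fin k → Ω} {i : Fin n} {w : Ω} :
    w ∈ held ω i ↔ ∃ l, ω i l = w := by
  simp [held]

namespace Mechanism

/-- Expected value of `g` over the random bits when the agents send the signals `a`. -/
noncomputable def bitsExpect (M : Mechanism n Ω) (g : Outcome n Ω → ℝ)
    (a : (i : Fin n) → M.Signal i) : ℝ≥0∞ :=
  ∑' b : M.Bits, M.bitsLaw b * ENNReal.ofReal (g (M.alloc a b))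

theorem expect_eq_tsum_bitsExpect (M : Mechanism n Ω) (g : Outcome n Ω → ℝ)
    (s : (i : Fin n) → PMF (M.Signal i)) :
    M.expect g s = ∑' a, (∏ i, s i (a i)) * M.bitsExpect g a := rfl

theorem prod_update_apply (M : Mechanism n Ω) (s : (i : Fin n) → PMF (M.Signal i)) (i : Fin n)
    (t : PMF (M.Signal i)) (a : (i : Fin n) → M.Signal i) :
    ∏ j, (Function.update s i t) j (a j) = t (a i) * ∏ j ∈ Finset.univ.erase i, s j (a j) := by
  rw [← Finset.mul_prod_erase _ _ (Finset.mem_univ i), Function.update_self]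
  congr 1
  refine Finset.prod_congr rfl fun j hj => ?_
  rw [Function.update_of_ne (Finset.ne_of_mem_erase hj)]

/-- Expected utility is linear in the mixed signal of each agent. -/
theorem expect_eq_tsum_update_pure (M : Mechanism n Ω) (g : Outcome n Ω → ℝ)
    (s : (i : Fin n) → PMF (M.Signal i)) (i : Fin n) :
    M.expect g s = ∑' c, s i c * M.expect g (Function.update s i (PMF.pure c)) := by
  classical
  simp only [expect_eq_tsum_bitsExpect, prod_update_apply, ← ENNReal.tsum_mul_left]
  rw [ENNReal.tsum_comm]
  refine tsum_congr fun a => ?_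
  rw [tsum_eq_single (a i) fun c hc => by simp [PMF.pure_apply, hc.symm]]
  rw [← Finset.mul_prod_erase _ _ (Finset.mem_univ i)]
  simp [PMF.pure_apply, mul_assoc]

/-- Finite supports reduce the sum over profiles to a finite one, which factors by distributivity.
-/
theorem tsum_prod_eq_one (M : Mechanism n Ω) (s : (i : Fin n) → PMF (M.Signal i))
    (hs : ∀ i, (s i).support.Finite) : ∑' a : (i : Fin n) → M.Signal i, ∏ i, s i (a i) = 1 := by
  classical
  rw [tsum_eq_sum (s := Fintype.piFinset fun i => (hs i).toFinset), ← Finset.prod_univ_sum]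
  · refine Finset.prod_eq_one fun i _ => ?_
    rw [← (s i).tsum_coe, tsum_eq_sum]
    intro c hc
    simpa using hc
  · intro a ha
    simp only [Fintype.mem_piFinset, Set.Finite.mem_toFinset, not_forall] at ha
    obtain ⟨i, hi⟩ := ha
    exact Finset.prod_eq_zero (Finset.mem_univ i) (by simpa using hi)

theorem expect_le (M : Mechanism n Ω) (g : Outcome n Ω → ℝ) (s : (i : Fin n) → PMF (M.Signal i))
    (hs : ∀ i, (s i).support.Finite) (C : ℝ≥0∞)
    (h : ∀ a, (∀ i, a i ∈ (s i).support) → M.bitsExpect g a ≤ C) : M.expect g s ≤ C := by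
  rw [expect_eq_tsum_bitsExpect]
  calc _ ≤ ∑' a : (i : Fin n) → M.Signal i, (∏ i, s i (a i)) * C := by
        refine ENNReal.tsum_le_tsum fun a => ?_
        by_cases ha : ∀ i, a i ∈ (s i).support
        · gcongr
          exact h a ha
        · push Not at ha
          obtain ⟨i, hi⟩ := ha
          rw [Finset.prod_eq_zero (Finset.mem_univ i) (by simpa using hi), zero_mul]
          exact zero_le
    _ = C := by rw [ENNReal.tsum_mul_right, M.tsum_prod_eq_one s hs, one_mul]

theorem le_expect (M : Mechanism n Ω) (g : Outcome n Ω → ℝ) (s : (i : Fin n) → PMF (M.Signal i))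
    (hs : ∀ i, (s i).support.Finite) (C : ℝ≥0∞)
    (h : ∀ a, (∀ i, a i ∈ (s i).support) → C ≤ M.bitsExpect g a) : C ≤ M.expect g s := by
  rw [expect_eq_tsum_bitsExpect]
  calc C = ∑' a : (i : Fin n) → M.Signal i, (∏ i, s i (a i)) * C := by
        rw [ENNReal.tsum_mul_right, M.tsum_prod_eq_one s hs, one_mul]
    _ ≤ _ := by
        refine ENNReal.tsum_le_tsum fun a => ?_
        by_cases ha : ∀ i, a i ∈ (s i).support
        · gcongr
          exact h a ha
        · push Not at ha
          obtain ⟨i, hi⟩ := ha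
          rw [Finset.prod_eq_zero (Finset.mem_univ i) (by simpa using hi), zero_mul]
          exact zero_le

theorem bitsExpect_eq_zero_of_expect_eq_zero (M : Mechanism n Ω) (g : Outcome n Ω → ℝ)
    (s : (i : Fin n) → PMF (M.Signal i)) (h : M.expect g s = 0) (a : (i : Fin n) → M.Signal i)
    (ha : ∀ i, a i ∈ (s i).support) : M.bitsExpect g a = 0 := by
  rw [expect_eq_tsum_bitsExpect, ENNReal.tsum_eq_zero] at h
  refine (mul_eq_zero.1 (h a)).resolve_left (Finset.prod_ne_zero_iff.2 fun i _ => ?_)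
  exact (PMF.mem_support_iff _ _).1 (ha i)

/-- An agent with a signal in the support of the equilibrium strategy that yields nothing gets
nothing in equilibrium. -/
theorem expect_eq_zero_of_pure_eq_zero (M : Mechanism n Ω) (g : Outcome n Ω → ℝ)
    (s : (i : Fin n) → PMF (M.Signal i)) (i : Fin n) (hfin : M.expect g s ≠ ∞)
    (hle : ∀ c ∈ (s i).support, M.expect g (Function.update s i (PMF.pure c)) ≤ M.expect g s)
    {c₀ : M.Signal i} (hc₀ : c₀ ∈ (s i).support)
    (h₀ : M.expect g (Function.update s i (PMF.pure c₀)) = 0) : M.expect g s = 0 := by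
  classical
  set U := M.expect g s with hU
  -- `U` is the average of pure payoffs, all at most `U`. The term of `c₀` contributes nothing, so
  -- `s i c₀ * U` can be added without passing `U`; finiteness of `U` then allows cancellation.
  have h1 : U + s i c₀ * U ≤ U := by
    calc U + s i c₀ * U
        = ∑' c, (s i c * M.expect g (Function.update s i (PMF.pure c))
            + if c = c₀ then s i c₀ * U else 0) := by
          rw [ENNReal.tsum_add, ← expect_eq_tsum_update_pure, tsum_ite_eq]
      _ ≤ ∑' c, s i c * U := by
          refine ENNReal.tsum_le_tsum fun c => ?_
          split_ifs with hc
          · rw [hc, h₀, mul_zero, zero_add]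
          · rw [add_zero]
            by_cases hcs : c ∈ (s i).support
            · gcongr
              exact hle c hcs
            · rw [(PMF.apply_eq_zero_iff _ _).2 hcs, zero_mul, zero_mul]
      _ = U := by rw [ENNReal.tsum_mul_right, (s i).tsum_coe, one_mul]
  have h2 : s i c₀ * U = 0 := by
    have h3 : U + s i c₀ * U ≤ U + 0 := by simpa using h1
    exact le_antisymm ((ENNReal.add_le_add_iff_left hfin).1 h3) zero_le
  exact (mul_eq_zero.1 h2).resolve_left ((PMF.mem_support_iff _ _).1 hc₀)

/-- If agent `i` makes with positive probability in equilibrium a proposal `c₀` that never wins, then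
the deviation to any `d` never wins either; a bound on `g` that holds at every profile where the
deviation to `d` does not win is a bound on its expectation. -/
theorem le_expect_of_deviation_loses (M : Mechanism n Ω) (y : Fin n → Ω → ℝ)
    (hy : ∀ i w, 0 < y i w) {k : ℕ} (ω : Fin n → Fin k → Ω) (s : (i : Fin n) → PMF (M.Signal i))
    (hs : M.IsNash y ω s) (hfin : ∀ i, (s i).support.Finite) (i : Fin n) {c₀ d : M.Signal i}
    (hc₀ : c₀ ∈ (s i).support) (hd : d ∈ M.feasible i (held ω i)) (g : Outcome n Ω → ℝ) (v : ℝ≥0∞)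
    (hlose : ∀ a : (i : Fin n) → M.Signal i, (∀ j ≠ i, a j ∈ (s j).support) → a i = c₀ →
      M.bitsExpect (agentValue y i) a = 0)
    (hv : ∀ a : (i : Fin n) → M.Signal i, (∀ j, a j ∈ (s j).support) →
      M.bitsExpect (agentValue y i) (Function.update a i d) = 0 → v ≤ M.bitsExpect g a) :
    v ≤ M.expect g s := by
  classical
  have hpure : ∀ c ∈ M.feasible i (held ω i),
      M.expect (agentValue y i) (Function.update s i (PMF.pure c)) ≤
        M.expect (agentValue y i) s := by
    intro c hc
    refine hs.2 i (PMF.pure c) ?_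
    rw [PMF.support_pure]
    simpa using hc
  -- The agent can only win with one of his own finitely many solutions, so the sum of their
  -- utilities is a bound.
  have hUfin : M.expect (agentValue y i) s ≠ ∞ := by
    refine ne_top_of_le_ne_top (ENNReal.ofReal_ne_top (r := ∑ m, y i (ω i m)))
      (M.expect_le _ _ hfin _ fun a ha => ?_)
    have hb : ∀ b, agentValue y i (M.alloc a b) ≤ ∑ m, y i (ω i m) := by
      intro b
      cases hp : M.alloc a b with
      | none => exact Finset.sum_nonneg fun m _ => (hy i _).le
      | some p =>
        simp only [agentValue]
        split_ifs with hpi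
        · have := M.winner_mem (held ω) a b p.1 p.2 (fun m => hs.1 m (ha m)) hp
          rw [hpi] at this
          obtain ⟨m, hm⟩ := mem_held.1 this
          rw [← hm]
          exact Finset.single_le_sum (f := fun m => y i (ω i m)) (fun m _ => (hy i _).le)
            (Finset.mem_univ m)
        · exact Finset.sum_nonneg fun m _ => (hy i _).le
    calc M.bitsExpect (agentValue y i) a
        ≤ ∑' b, M.bitsLaw b * ENNReal.ofReal (∑ m, y i (ω i m)) :=
          ENNReal.tsum_le_tsum fun b => by gcongr; exact hb b
      _ = ENNReal.ofReal (∑ m, y i (ω i m)) := by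
          rw [ENNReal.tsum_mul_right, PMF.tsum_coe, one_mul]
  have h₀ : M.expect (agentValue y i) (Function.update s i (PMF.pure c₀)) = 0 := by
    refine le_antisymm (M.expect_le _ _ (fun m => ?_) _ fun a ha => ?_) zero_le
    · by_cases hm : m = i
      · subst hm; rw [Function.update_self, PMF.support_pure]; exact Set.finite_singleton _
      · rw [Function.update_of_ne hm]; exact hfin m
    · refine (hlose a (fun j hj => ?_) ?_).le
      · simpa only [Function.update_of_ne hj] using ha j
      · simpa only [Function.update_self, PMF.support_pure, Set.mem_singleton_iff] using ha i
  have hU : M.expect (agentValue y i) s = 0 :=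
    M.expect_eq_zero_of_pure_eq_zero _ s i hUfin (fun c hc => hpure c (hs.1 i hc)) hc₀ h₀
  have hdev : M.expect (agentValue y i) (Function.update s i (PMF.pure d)) = 0 :=
    le_antisymm ((hpure _ hd).trans hU.le) zero_le
  -- Zero expected payoff of the deviation means zero payoff at each profile in the support, not
  -- only on average.
  refine M.le_expect _ _ hfin _ fun a ha => hv a ha ?_
  refine M.bitsExpect_eq_zero_of_expect_eq_zero _ _ hdev _ fun m => ?_
  by_cases hm : m = i
  · subst hm
    rw [Function.update_self, Function.update_self, PMF.support_pure]
    exact Set.mem_singleton _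
  · rw [Function.update_of_ne hm, Function.update_of_ne hm]; exact ha m

end Mechanism

theorem singleProposal_bitsExpect (x : Ω → ℝ) (rank : Equiv.Perm (Fin n)) (g : Outcome n Ω → ℝ)
    (a : Fin n → Option Ω) :
    (singleProposal x (fun _ => Set.univ) rank).bitsExpect g a =
      ENNReal.ofReal (g ((singleProposal x (fun _ => Set.univ) rank).alloc a ())) := by
  change ∑' b : Unit, (PMF.pure () : PMF Unit) b * _ = _
  rw [tsum_eq_single (() : Unit) (fun b hb => absurd rfl hb), PMF.pure_apply, if_pos rfl, one_mul]

theorem finite_support_of_subset_feasible {k : ℕ} (x : Ω → ℝ) (rank : Equiv.Perm (Fin n))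
    (ω : Fin n → Fin k → Ω) (i : Fin n) (t : PMF (Option Ω))
    (h : t.support ⊆ (singleProposal x (fun _ => Set.univ) rank).feasible i (held ω i)) :
    t.support.Finite := by
  refine ((Set.finite_range (ω i)).image some |>.insert none).subset fun c hc => ?_
  cases c with
  | none => exact Or.inl rfl
  | some w =>
    obtain ⟨l, hl⟩ := mem_held.1 (h hc w rfl)
    exact Or.inr ⟨w, ⟨l, hl⟩, rfl⟩

/-- If the deviation of agent `i` to `w` does not win, then the principal gets at least `x w`. -/
theorem le_principalValue_alloc (x : Ω → ℝ) (rank : Equiv.Perm (Fin n))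
    (y : Fin n → Ω → ℝ) (hy : ∀ i w, 0 < y i w) (a : Fin n → Option Ω) {i : Fin n} {w : Ω}
    (hz : agentValue y i ((singleProposal x (fun _ => Set.univ) rank).alloc
      (Function.update a i (some w)) ()) ≤ 0) :
    x w ≤ principalValue x ((singleProposal x (fun _ => Set.univ) rank).alloc a ()) := by
  obtain ⟨p, hp, hp2, hp3⟩ := singleProposal_alloc_spec x rank
    (Function.update a i (some w)) (i := i) (w := w) (Function.update_self _ _ _)
  have hpi : p.1 ≠ i := by
    intro h
    have hz' := (congrArg (agentValue y i) hp).symm.trans_le hz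
    simp only [agentValue, h, if_true] at hz'
    exact absurd hz' (hy i _).not_ge
  rw [Function.update_of_ne hpi] at hp2
  have hp4 := hp3 i
  rw [Function.update_self] at hp4
  -- The winner `p` against the deviation belongs to another agent, so the same proposal already
  -- competes in `a`, and the winner `q` there is at least as strong.
  obtain ⟨q, hq, -, hq3⟩ := singleProposal_alloc_spec x rank a hp2
  have hq4 := hq3 p.1
  rw [hp2] at hq4
  rw [hq]
  exact (le_of_strength_le hp4).trans (le_of_strength_le hq4)

/-- If agent `j` always proposes something at least as strong as the proposal `c₀`, which agent `i`
makes with positive probability in equilibrium, then the principal's value is at least the value of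
everything that agent `i` has found. -/
theorem le_expect_principalValue_of_dominated (x : Ω → ℝ) (rank : Equiv.Perm (Fin n))
    (y : Fin n → Ω → ℝ) (hy : ∀ i w, 0 < y i w) {k : ℕ} (ω : Fin n → Fin k → Ω)
    (s : Fin n → PMF (Option Ω))
    (hs : (singleProposal x (fun _ => Set.univ) rank).IsNash y ω s) {i j : Fin n} (hij : i ≠ j)
    {c₀ : Option Ω} (hc₀ : c₀ ∈ (s i).support)
    (hdom : ∀ c ∈ (s j).support, strength x rank i c₀ ≤ strength x rank j c) (l : Fin k) :
    ENNReal.ofReal (x (ω i l)) ≤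
      (singleProposal x (fun _ => Set.univ) rank).expect (principalValue x) s := by
  have hfin : ∀ i, (s i).support.Finite := fun i =>
    finite_support_of_subset_feasible x rank ω i (s i) (hs.1 i)
  refine Mechanism.le_expect_of_deviation_loses (singleProposal x (fun _ => Set.univ) rank) y hy ω s
    hs hfin i (c₀ := c₀) (d := some (ω i l)) hc₀
    (fun w hw => mem_held.2 ⟨l, Option.some.inj hw⟩) _ _ (fun a ha hai => ?_) (fun a ha hz => ?_)
  · refine (singleProposal_bitsExpect x rank _ a).trans ?_
    rw [agentValue_alloc_eq_zero x rank y a hij, ENNReal.ofReal_zero]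
    exact (congrArg _ hai).trans_le (hdom _ (ha j hij.symm))
  · refine le_trans ?_ (singleProposal_bitsExpect x rank _ a).ge
    refine ENNReal.ofReal_le_ofReal ?_
    have hz' := (singleProposal_bitsExpect x rank (agentValue y i)
      (Function.update a i (some (ω i l)))).symm.trans hz
    exact le_principalValue_alloc x rank y hy a (ENNReal.ofReal_eq_zero.1 hz')

/-- In every equilibrium, and for any two agents, the principal's expected utility is at least the
smaller of the values of two solutions found by the two agents. -/
theorem min_le_expect_principalValue (x : Ω → ℝ) (rank : Equiv.Perm (Fin n))
    (y : Fin n → Ω → ℝ) (hy : ∀ i w, 0 < y i w) {k : ℕ} (ω : Fin n → Fin k → Ω)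
    (s : Fin n → PMF (Option Ω))
    (hs : (singleProposal x (fun _ => Set.univ) rank).IsNash y ω s) {i j : Fin n} (hij : i ≠ j)
    (l m : Fin k) :
    ENNReal.ofReal (min (x (ω i l)) (x (ω j m))) ≤
      (singleProposal x (fun _ => Set.univ) rank).expect (principalValue x) s := by
  have hfin : ∀ i, (s i).support.Finite := fun i =>
    finite_support_of_subset_feasible x rank ω i (s i) (hs.1 i)
  -- The weakest proposals in the two supports; the weaker of them is dominated by everything the
  -- other agent plays.
  obtain ⟨c, hc, hcmin⟩ := Set.exists_min_image _ (strength x rank i) (hfin i) (s i).support_nonempty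
  obtain ⟨d, hd, hdmin⟩ := Set.exists_min_image _ (strength x rank j) (hfin j) (s j).support_nonempty
  rcases le_total (strength x rank i c) (strength x rank j d) with h | h
  · exact (ENNReal.ofReal_le_ofReal (min_le_left _ _)).trans
      (le_expect_principalValue_of_dominated x rank y hy ω s hs hij hc
        (fun e he => h.trans (hdmin e he)) l)
  · exact (ENNReal.ofReal_le_ofReal (min_le_right _ _)).trans
      (le_expect_principalValue_of_dominated x rank y hy ω s hs hij.symm hd
        (fun e he => h.trans (hcmin e he)) m)

end Game

/-! ### The probability integral transform, and the law of a maximum of independent draws. -/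

section Cdf

variable {D ν : Measure ℝ} [IsProbabilityMeasure D] [IsProbabilityMeasure ν]

theorem continuous_cdf [NullSingletonClass D] : Continuous (cdf D) := by
  refine continuous_iff_continuousAt.2 fun a => ?_
  rw [(monotone_cdf D).continuousAt_iff_leftLim_eq_rightLim, StieltjesFunction.rightLim_eq]
  have h : (cdf D).measure {a} = 0 := by rw [measure_cdf]; exact measure_singleton a
  rw [StieltjesFunction.measure_singleton, ENNReal.ofReal_eq_zero, sub_nonpos] at h
  exact le_antisymm ((monotone_cdf D).leftLim_le le_rfl) h

theorem exists_cdf_eq [NullSingletonClass D] {u : ℝ} (h0 : 0 < u) (h1 : u < 1) :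
    ∃ t, cdf D t = u :=
  mem_range_of_exists_le_of_exists_ge continuous_cdf
    (((tendsto_cdf_atBot D).eventually (gt_mem_nhds h0)).exists.imp fun _ => le_of_lt)
    (((tendsto_cdf_atTop D).eventually (lt_mem_nhds h1)).exists.imp fun _ => le_of_lt)

theorem measurable_cdf {D : Measure ℝ} : Measurable (cdf D) := (monotone_cdf D).measurable

/-- The probability integral transform: the c.d.f. of an atomless law transforms it into the uniform
distribution on the unit interval. -/
theorem map_cdf_eq_uniform [NullSingletonClass D] :
    D.map (cdf D) = volume.restrict (Set.Icc (0 : ℝ) 1) := by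
  have : IsProbabilityMeasure (D.map (cdf D)) := Measure.isProbabilityMeasure_map
    measurable_cdf.aemeasurable
  refine Measure.ext_of_Iic _ _ fun u => ?_
  rw [Measure.map_apply measurable_cdf measurableSet_Iic, Measure.restrict_apply measurableSet_Iic]
  rcases lt_or_ge u 0 with hu | hu
  · have h1 : cdf D ⁻¹' Set.Iic u = ∅ := by
      ext s; simpa using hu.trans_le (cdf_nonneg D s)
    have h2 : Set.Iic u ∩ Set.Icc 0 1 = ∅ := by
      rw [Set.eq_empty_iff_forall_notMem]
      rintro s ⟨h, h', -⟩
      exact absurd (h.trans_lt hu) h'.not_gt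
    rw [h1, h2, measure_empty, measure_empty]
  rcases le_or_gt 1 u with hu1 | hu1
  · have h1 : cdf D ⁻¹' Set.Iic u = Set.univ := by
      ext s; simpa using (cdf_le_one D s).trans hu1
    have h2 : Set.Iic u ∩ Set.Icc 0 1 = Set.Icc 0 1 :=
      Set.inter_eq_right.2 fun s hs => hs.2.trans hu1
    rw [h1, h2, measure_univ, Real.volume_Icc, sub_zero, ENNReal.ofReal_one]
  have h2 : Set.Iic u ∩ Set.Icc 0 1 = Set.Icc 0 u := by
    ext s; simp only [Set.mem_inter_iff, Set.mem_Iic, Set.mem_Icc]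
    constructor
    · rintro ⟨h, h', -⟩; exact ⟨h', h⟩
    · rintro ⟨h, h'⟩; exact ⟨h', h, by linarith⟩
  rw [h2, Real.volume_Icc, sub_zero]
  refine le_antisymm ?_ ?_
  · have key : ∀ v, u < v → v < 1 → D (cdf D ⁻¹' Set.Iic u) ≤ ENNReal.ofReal v := by
      intro v huv hv
      obtain ⟨t, ht⟩ := exists_cdf_eq (D := D) (hu.trans_lt huv) hv
      rw [← ht, ofReal_cdf]
      refine measure_mono fun s hs => ?_
      by_contra hst
      have h3 := monotone_cdf D (not_le.1 hst).le
      have h4 : cdf D s ≤ u := hs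
      linarith
    have hlim : Tendsto (fun v => ENNReal.ofReal v) (𝓝[>] u) (𝓝 (ENNReal.ofReal u)) :=
      (ENNReal.continuous_ofReal.tendsto u).mono_left nhdsWithin_le_nhds
    refine ge_of_tendsto hlim ?_
    filter_upwards [Ioo_mem_nhdsGT hu1] with v hv using key v hv.1 hv.2
  · rcases hu.eq_or_lt with rfl | hu0
    · simp
    · obtain ⟨t, ht⟩ := exists_cdf_eq (D := D) hu0 hu1
      nth_rewrite 1 [← ht]
      rw [ofReal_cdf]
      exact measure_mono fun s hs => (monotone_cdf D hs).trans ht.le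

/-- The two sets differ by a stretch on which the c.d.f. is constant, which is null. This allows the
substitution `u = F(s)` on half-lines. -/
theorem Iic_ae_eq_preimage_cdf [NullSingletonClass D] (t : ℝ) :
    Set.Iic t =ᵐ[D] cdf D ⁻¹' Set.Iic (cdf D t) := by
  refine ae_eq_of_subset_of_measure_ge (fun s hs => monotone_cdf D hs) ?_
    measurableSet_Iic.nullMeasurableSet (measure_ne_top _ _)
  rw [← Measure.map_apply measurable_cdf measurableSet_Iic, map_cdf_eq_uniform,
    Measure.restrict_apply measurableSet_Iic, ← ofReal_cdf]
  calc volume (Set.Iic (cdf D t) ∩ Set.Icc 0 1) ≤ volume (Set.Icc 0 (cdf D t)) :=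
        measure_mono fun s hs => ⟨hs.2.1, hs.1⟩
    _ = ENNReal.ofReal (cdf D t) := by rw [Real.volume_Icc, sub_zero]

theorem Ioi_ae_eq_preimage_cdf [NullSingletonClass D] (t : ℝ) :
    Set.Ioi t =ᵐ[D] cdf D ⁻¹' Set.Ioi (cdf D t) := by
  have := (Iic_ae_eq_preimage_cdf (D := D) t).compl
  rwa [Set.compl_Iic, ← Set.preimage_compl, Set.compl_Iic] at this

theorem integral_comp_cdf [NullSingletonClass D] {φ : ℝ → ℝ} (hφ : Measurable φ) :
    ∫ s, φ (cdf D s) ∂D = ∫ u in (0 : ℝ)..1, φ u := by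
  rw [← integral_map (f := φ) measurable_cdf.aemeasurable hφ.aestronglyMeasurable,
    map_cdf_eq_uniform, intervalIntegral.integral_of_le zero_le_one, integral_Icc_eq_integral_Ioc]

theorem setIntegral_Ioi_comp_cdf [NullSingletonClass D] {φ : ℝ → ℝ} (hφ : Measurable φ) (t : ℝ) :
    ∫ s in Set.Ioi t, φ (cdf D s) ∂D = ∫ u in (cdf D t)..1, φ u := by
  rw [setIntegral_congr_set (Ioi_ae_eq_preimage_cdf t),
    ← setIntegral_map (f := φ) measurableSet_Ioi hφ.aestronglyMeasurable
      measurable_cdf.aemeasurable, map_cdf_eq_uniform, intervalIntegral.integral_of_le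
      (cdf_le_one D t), Measure.restrict_restrict measurableSet_Ioi]
  congr 2
  ext s; simp only [Set.mem_inter_iff, Set.mem_Ioi, Set.mem_Icc, Set.mem_Ioc]
  constructor
  · rintro ⟨h, -, h'⟩; exact ⟨h, h'⟩
  · rintro ⟨h, h'⟩; exact ⟨h, (cdf_nonneg D t).trans h.le, h'⟩

theorem one_sub_cdf (t : ℝ) : 1 - cdf D t = D.real (Set.Ioi t) := by
  rw [cdf_eq_real, ← Set.compl_Iic, probReal_compl_eq_one_sub measurableSet_Iic]

/-- The law of the maximum of `k` independent draws has density `k F ^ (k - 1)` with respect to the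
law of one draw. -/
theorem eq_withDensity_of_cdf_eq_pow [NullSingletonClass D] {k : ℕ} (hk : 1 ≤ k)
    (h : ∀ t, cdf ν t = cdf D t ^ k) :
    ν = D.withDensity fun t => ENNReal.ofReal (k * cdf D t ^ (k - 1)) := by
  have hm : Measurable fun u : ℝ => ENNReal.ofReal (k * u ^ (k - 1)) := by fun_prop
  refine Measure.ext_of_Iic _ _ fun t => ?_
  rw [withDensity_apply _ measurableSet_Iic, setLIntegral_congr (Iic_ae_eq_preimage_cdf t),
    ← setLIntegral_map measurableSet_Iic hm measurable_cdf, map_cdf_eq_uniform,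
    Measure.restrict_restrict measurableSet_Iic, ← ofReal_cdf, h]
  have h2 : Set.Iic (cdf D t) ∩ Set.Icc 0 1 = Set.Icc 0 (cdf D t) := by
    ext s; simp only [Set.mem_inter_iff, Set.mem_Iic, Set.mem_Icc]
    constructor
    · rintro ⟨h, h', -⟩; exact ⟨h', h⟩
    · rintro ⟨h, h'⟩; exact ⟨h', h, h'.trans (cdf_le_one D t)⟩
  rw [h2, ← ofReal_integral_eq_lintegral_ofReal]
  · congr 1
    rw [integral_Icc_eq_integral_Ioc, ← intervalIntegral.integral_of_le (cdf_nonneg D t),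
      intervalIntegral.integral_const_mul, integral_pow, Nat.sub_add_cancel hk]
    have : (k : ℝ) ≠ 0 := by positivity
    have hk' : ((k - 1 : ℕ) : ℝ) + 1 = k := by
      rw [Nat.cast_sub hk]; push_cast; ring
    rw [hk', zero_pow (by omega), sub_zero]
    field_simp
  · exact (Continuous.integrableOn_Icc (by fun_prop))
  · filter_upwards [ae_restrict_mem measurableSet_Icc] with u hu
    have := hu.1
    positivity

theorem nullSingletonClass_of_hasMHR {D : Measure ℝ} (h : HasMHR D) : NullSingletonClass D := by
  obtain ⟨f, -, -, rfl, -⟩ := h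
  infer_instance

/-- For positive `u` the reciprocal is a sum of nonpositive powers of `u`. This is the factor by
which taking a maximum changes the hazard rate. -/
theorem monotoneOn_pow_div_sum_pow (k : ℕ) :
    MonotoneOn (fun u : ℝ => u ^ (k - 1) / ∑ j ∈ Finset.range k, u ^ j) (Set.Ici 0) := by
  intro u hu v hv huv
  simp only [Set.mem_Ici] at hu hv
  rcases Nat.eq_zero_or_pos k with rfl | hk
  · simp
  have hpos : ∀ w : ℝ, 0 ≤ w → 0 < ∑ j ∈ Finset.range k, w ^ j := fun w hw => by
    have : (1 : ℝ) ≤ ∑ j ∈ Finset.range k, w ^ j := by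
      simpa using Finset.single_le_sum (f := fun j => w ^ j) (fun j _ => pow_nonneg hw j)
        (Finset.mem_range.2 hk)
    linarith
  show u ^ (k - 1) / _ ≤ v ^ (k - 1) / _
  rw [div_le_div_iff₀ (hpos u hu) (hpos v hv), Finset.mul_sum, Finset.mul_sum]
  refine Finset.sum_le_sum fun j hj => ?_
  have hj : k - 1 = (k - 1 - j) + j := by have := Finset.mem_range.1 hj; omega
  rw [hj, pow_add, pow_add, mul_assoc, mul_assoc, mul_comm (v ^ j)]
  gcongr

/-- The law of the maximum of independent draws from a law with monotone hazard rate has a monotone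
hazard rate. -/
theorem HasMHR.of_cdf_eq_pow (hD : HasMHR D) {k : ℕ} (hk : 1 ≤ k)
    (h : ∀ t, cdf ν t = cdf D t ^ k) : HasMHR ν := by
  have := nullSingletonClass_of_hasMHR hD
  obtain ⟨f, hf, hf0, hDf, hmono⟩ := hD
  have hF0 := cdf_nonneg D
  refine ⟨fun t => k * cdf D t ^ (k - 1) * f t, ?_, fun t => ?_, ?_, ?_⟩
  · exact (measurable_const.mul (measurable_cdf.pow_const _)).mul hf
  · have := hF0 t; have := hf0 t; positivity
  · have hν := eq_withDensity_of_cdf_eq_pow hk h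
    have hm : Measurable fun t => ENNReal.ofReal (k * cdf D t ^ (k - 1)) :=
      (measurable_const.mul (measurable_cdf.pow_const _)).ennreal_ofReal
    rw [hν]
    -- Shields the c.d.f. from the rewriting of `D` as a measure with density.
    set F := cdf D
    conv_lhs => rw [hDf]
    rw [← withDensity_mul _ hf.ennreal_ofReal hm]
    congr 1
    ext t
    have := hF0 t
    rw [Pi.mul_apply, mul_comm, ← ENNReal.ofReal_mul (by positivity)]
  · have hset : {t | cdf ν t < 1} = {t | cdf D t < 1} := by
      ext t
      simp only [Set.mem_ofPred_eq, h]
      exact pow_lt_one_iff_of_nonneg (hF0 t) (by omega)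
    rw [hset]
    -- Since `1 - F^k = (1 - F) ∑ F^j`, the new hazard rate is the old one times an increasing
    -- function of `F`.
    have hprod : MonotoneOn (fun t => k * ((f t / (1 - cdf D t)) *
        (cdf D t ^ (k - 1) / ∑ j ∈ Finset.range k, cdf D t ^ j))) {t | cdf D t < 1} := by
      intro s hs t ht hst
      have hs1 : 0 < 1 - cdf D s := sub_pos.2 hs
      have ht1 : 0 < 1 - cdf D t := sub_pos.2 ht
      have h1 := hmono hs ht hst
      have h2 := monotoneOn_pow_div_sum_pow k (hF0 s) (hF0 t) (monotone_cdf D hst)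
      simp only at h1 h2 ⊢
      have h3 : 0 ≤ cdf D s ^ (k - 1) / ∑ j ∈ Finset.range k, cdf D s ^ j :=
        div_nonneg (pow_nonneg (hF0 s) _) (Finset.sum_nonneg fun j _ => pow_nonneg (hF0 s) _)
      have h4 : 0 ≤ f t / (1 - cdf D t) := div_nonneg (hf0 t) ht1.le
      gcongr
    refine hprod.congr fun t ht => ?_
    have ht1 : 1 - cdf D t ≠ 0 := (sub_pos.2 ht).ne'
    simp only [h]
    rw [div_mul_div_comm, mul_neg_geom_sum]
    ring

end Cdf

/-! ### Moments, expected gaps and the Gini mean difference under a monotone hazard rate. -/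

section MonotoneHazardRate

variable {ν : Measure ℝ} [IsProbabilityMeasure ν]

/-- At every level strictly between zero and one, a density of a law with monotone hazard rate
crosses a positive multiple of the tail function. -/
theorem exists_density_crossing {g : ℝ → ℝ} (hg0 : ∀ t, 0 ≤ g t)
    (hν : ν = volume.withDensity fun t => ENNReal.ofReal (g t))
    (hmono : MonotoneOn (fun t => g t / (1 - cdf ν t)) {t | cdf ν t < 1})
    {u : ℝ} (h0 : 0 < u) (h1 : u < 1) :
    ∃ t₀ c, cdf ν t₀ = u ∧ 0 < c ∧ (∀ t ≤ t₀, g t ≤ c * (1 - cdf ν t)) ∧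
      ∀ t, t₀ ≤ t → c * (1 - cdf ν t) ≤ g t := by
  have : NullSingletonClass ν := by rw [hν]; infer_instance
  obtain ⟨t₀, ht₀⟩ := exists_cdf_eq (D := ν) h0 h1
  have hlt : ∀ t ≤ t₀, cdf ν t < 1 := fun t ht => (monotone_cdf ν ht).trans_lt (ht₀.trans_lt h1)
  have hle : ∀ t ≤ t₀, g t ≤ g t₀ / (1 - cdf ν t₀) * (1 - cdf ν t) := fun t ht => by
    rw [← div_le_iff₀ (sub_pos.2 (hlt t ht))]
    exact hmono (hlt t ht) (hlt t₀ le_rfl) ht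
  -- The multiple is the hazard rate at `t₀`. Were it zero, `g` would vanish up to `t₀`, against
  -- `cdf ν t₀ = u > 0`.
  refine ⟨t₀, g t₀ / (1 - cdf ν t₀), ht₀, ?_, hle, fun t ht => ?_⟩
  · refine lt_of_le_of_ne (div_nonneg (hg0 _) (sub_pos.2 (hlt t₀ le_rfl)).le) fun hc => ?_
    have hzero : ν (Set.Iic t₀) = 0 := by
      rw [hν, withDensity_apply _ measurableSet_Iic]
      refine setLIntegral_eq_zero measurableSet_Iic fun t ht => ?_
      have := hle t ht
      rw [← hc, zero_mul] at this
      exact ENNReal.ofReal_eq_zero.2 this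
    rw [← ofReal_cdf, ht₀, ENNReal.ofReal_eq_zero] at hzero
    exact absurd h0 hzero.not_gt
  · rcases (cdf_le_one ν t).lt_or_eq with h | h
    · rw [← le_div_iff₀ (sub_pos.2 h)]
      exact hmono (hlt t₀ le_rfl) h ht
    · rw [h, sub_self, mul_zero]
      exact hg0 t

/-- A positive law with monotone hazard rate has a finite second moment. -/
theorem memLp_two_of_hasMHR (h : HasMHR ν) (hpos : ν (Set.Iio 0) = 0) : MemLp id 2 ν := by
  obtain ⟨g, hg, hg0, hν, hmono⟩ := h
  obtain ⟨t₀, c, -, hc, -, htail⟩ := exists_density_crossing hg0 hν hmono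
    (u := 1 / 2) (by norm_num) (by norm_num)
  -- Beyond `t₀` the tail satisfies `c (1 - F) ≤ g`. By the layer-cake formula this gives `c E[Z] ≤
  -- ∫ g = 1`; weighted by the level `s`, it bounds the second moment of `Z` by a multiple of
  -- `E[Z]`.
  set Z : ℝ → ℝ := fun s => max (s - t₀) 0 with hZ
  have hZm : Measurable Z := (measurable_id.sub_const t₀).max measurable_const
  have hZ0 : ∀ s, 0 ≤ Z s := fun s => le_max_right _ _
  have hgm : Measurable fun t => ENNReal.ofReal (g t) := hg.ennreal_ofReal
  have htail' : ∀ s ∈ Set.Ioi (0 : ℝ), ENNReal.ofReal c * ν {a | s < Z a} ≤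
      ENNReal.ofReal (g (t₀ + s)) := by
    intro s hs
    have hset : {a | s < Z a} = Set.Ioi (t₀ + s) := by
      ext a
      simp only [hZ, Set.mem_ofPred_eq, Set.mem_Ioi, lt_max_iff]
      constructor
      · rintro (h | h)
        · linarith
        · exact absurd h (not_lt.2 (le_of_lt hs))
      · intro h; left; linarith
    rw [hset, ← ofReal_measureReal (measure_ne_top _ _), ← one_sub_cdf, ← ENNReal.ofReal_mul hc.le]
    exact ENNReal.ofReal_le_ofReal (htail _ (by have := hs.out; linarith))
  have hc' : ENNReal.ofReal c ≠ 0 := by simpa using hc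
  have hfirst : ∫⁻ s, ENNReal.ofReal (Z s) ∂ν ≠ ∞ := by
    rw [lintegral_eq_lintegral_meas_lt ν (ae_of_all _ hZ0) hZm.aemeasurable]
    intro htop
    have h1 : ENNReal.ofReal c * ∫⁻ s in Set.Ioi 0, ν {a | s < Z a} ≤ 1 := by
      rw [← lintegral_const_mul' _ _ ENNReal.ofReal_ne_top]
      calc _ ≤ ∫⁻ s in Set.Ioi 0, ENNReal.ofReal (g (t₀ + s)) :=
            setLIntegral_mono (hgm.comp (measurable_const_add t₀)) htail'
        _ ≤ ∫⁻ s, ENNReal.ofReal (g (t₀ + s)) := setLIntegral_le_lintegral _ _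
        _ = ∫⁻ s, ENNReal.ofReal (g s) :=
            lintegral_add_left_eq_self (fun s => ENNReal.ofReal (g s)) t₀
        _ = ν Set.univ := by rw [hν, withDensity_apply _ MeasurableSet.univ, Measure.restrict_univ]
        _ = 1 := measure_univ
    rw [htop, ENNReal.mul_top hc'] at h1
    exact absurd h1 (by simp)
  have hsecond : ∫⁻ s, ENNReal.ofReal (Z s ^ (2 : ℝ)) ∂ν ≠ ∞ := by
    rw [lintegral_rpow_eq_lintegral_meas_lt_mul ν (ae_of_all _ hZ0) hZm.aemeasurable two_pos]
    refine ENNReal.mul_ne_top ENNReal.ofReal_ne_top fun htop => ?_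
    have h1 : ENNReal.ofReal c *
        ∫⁻ s in Set.Ioi 0, ν {a | s < Z a} * ENNReal.ofReal (s ^ ((2 : ℝ) - 1)) ≤
          ∫⁻ s, ENNReal.ofReal (Z s) ∂ν := by
      rw [← lintegral_const_mul' _ _ ENNReal.ofReal_ne_top]
      calc _ ≤ ∫⁻ s in Set.Ioi 0, ENNReal.ofReal (g (t₀ + s)) * ENNReal.ofReal (Z (t₀ + s)) := by
            refine setLIntegral_mono ((hgm.comp (measurable_const_add t₀)).mul
              (hZm.comp (measurable_const_add t₀)).ennreal_ofReal) fun s hs => ?_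
            rw [← mul_assoc]
            refine mul_le_mul' (htail' s hs) (ENNReal.ofReal_le_ofReal ?_)
            rw [show (2 : ℝ) - 1 = 1 by norm_num, Real.rpow_one]
            simp [hZ]
        _ ≤ ∫⁻ s, ENNReal.ofReal (g (t₀ + s)) * ENNReal.ofReal (Z (t₀ + s)) :=
            setLIntegral_le_lintegral _ _
        _ = ∫⁻ s, ENNReal.ofReal (g s) * ENNReal.ofReal (Z s) :=
            lintegral_add_left_eq_self
              (fun s => ENNReal.ofReal (g s) * ENNReal.ofReal (Z s)) t₀
        _ = _ := by
            conv_rhs => rw [hν]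
            rw [lintegral_withDensity_eq_lintegral_mul _ hgm hZm.ennreal_ofReal]
            rfl
    rw [htop, ENNReal.mul_top hc'] at h1
    exact hfirst (top_le_iff.1 h1)
  have hZ2 : MemLp Z 2 ν := by
    rw [memLp_two_iff_integrable_sq hZm.aestronglyMeasurable]
    refine ⟨(hZm.pow_const 2).aestronglyMeasurable, ?_⟩
    rw [hasFiniteIntegral_iff_ofReal (ae_of_all _ fun s => sq_nonneg (Z s))]
    simpa using hsecond.lt_top
  refine (hZ2.add (memLp_const |t₀|)).mono measurable_id.aestronglyMeasurable ?_
  have hae : ∀ᵐ s ∂ν, 0 ≤ s := by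
    rw [ae_iff]; simpa [Set.Iio] using hpos
  filter_upwards [hae] with s hs
  have h1 : s - t₀ ≤ Z s := le_max_left _ _
  have h2 := le_abs_self t₀
  have h3 := hZ0 s
  have h4 : (0 : ℝ) ≤ |t₀| := abs_nonneg _
  rw [id, Pi.add_apply, Real.norm_of_nonneg hs, Real.norm_of_nonneg (by linarith)]
  linarith

theorem integrableOn_one_sub_cdf (hpos : ν (Set.Iio 0) = 0) (h : Integrable id ν) :
    IntegrableOn (fun t => 1 - cdf ν t) (Set.Ioi 0) := by
  refine ⟨(measurable_const.sub measurable_cdf).aestronglyMeasurable, ?_⟩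
  rw [hasFiniteIntegral_iff_ofReal (ae_of_all _ fun s => sub_nonneg.2 (cdf_le_one ν s))]
  have hae : ∀ᵐ s ∂ν, (0 : ℝ) ≤ id s := by
    rw [ae_iff]; simpa [Set.Iio] using hpos
  have h1 := (hasFiniteIntegral_iff_ofReal hae).1 h.2
  rw [lintegral_eq_lintegral_meas_lt ν hae measurable_id.aemeasurable] at h1
  refine lt_of_eq_of_lt (lintegral_congr fun t => ?_) h1
  rw [one_sub_cdf, ofReal_measureReal (measure_ne_top _ _)]
  rfl

theorem integrableOn_comp_cdf_mul (hpos : ν (Set.Iio 0) = 0) (h : Integrable id ν)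
    {φ : ℝ → ℝ} (hφ : Continuous φ) :
    IntegrableOn (fun t => φ (cdf ν t) * (1 - cdf ν t)) (Set.Ioi 0) := by
  obtain ⟨C, hC⟩ := isCompact_Icc.exists_bound_of_continuousOn (s := Set.Icc (0 : ℝ) 1)
    hφ.continuousOn
  exact (integrableOn_one_sub_cdf hpos h).bdd_mul
    (hφ.measurable.comp measurable_cdf).aestronglyMeasurable
    (ae_of_all _ fun t => hC _ ⟨cdf_nonneg ν t, cdf_le_one ν t⟩)

/-- Under a monotone hazard rate, the expected gap between the two largest of `n` draws is largest
for two draws. -/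
theorem integral_gap_le_of_hasMHR (h : HasMHR ν) (hpos : ν (Set.Iio 0) = 0) {n : ℕ} (hn : 2 ≤ n) :
    ∫ t in Set.Ioi 0, n * cdf ν t ^ (n - 1) * (1 - cdf ν t) ≤
      ∫ t in Set.Ioi 0, 2 * cdf ν t * (1 - cdf ν t) := by
  have hint : Integrable id ν := (memLp_two_of_hasMHR h hpos).integrable one_le_two
  have : NullSingletonClass ν := nullSingletonClass_of_hasMHR h
  rcases hn.eq_or_lt with rfl | hn3
  · simp
  obtain ⟨g, hg, hg0, hν, hmono⟩ := h
  have hnpos : (0 : ℝ) < n := by positivity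
  have hn2 : ((n - 2 : ℕ) : ℝ) ≠ 0 := by
    rw [Nat.cast_ne_zero]; omega
  -- The zero of `θ` inside the unit interval, which exists because `n ≥ 3` here.
  have hu : ∃ u : ℝ, 0 < u ∧ u < 1 ∧ n * u ^ (n - 2) = 2 := by
    refine ⟨(2 / n : ℝ) ^ ((1 : ℝ) / (n - 2 : ℕ)), by positivity, ?_, ?_⟩
    · refine Real.rpow_lt_one (by positivity) ?_ (by positivity)
      rw [div_lt_one hnpos]
      exact_mod_cast hn3
    · rw [← Real.rpow_natCast, ← Real.rpow_mul (by positivity), one_div, inv_mul_cancel₀ hn2,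
        Real.rpow_one, mul_div_cancel₀ _ hnpos.ne']
  obtain ⟨u, hu0, hu1, hun⟩ := hu
  obtain ⟨t₀, c, ht₀, hc, hlow, hhigh⟩ := exists_density_crossing hg0 hν hmono hu0 hu1
  set θ : ℝ → ℝ := fun v => n * v ^ (n - 1) - 2 * v with hθ
  have hθc : Continuous θ := by fun_prop
  have hθfac : ∀ v, θ v = v * (n * v ^ (n - 2) - n * u ^ (n - 2)) := fun v => by
    rw [hun]
    simp only [hθ]
    rw [show n - 1 = n - 2 + 1 by omega, pow_succ]
    ring
  have hθlow : ∀ v, 0 ≤ v → v ≤ u → θ v ≤ 0 := fun v hv hvu => by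
    rw [hθfac]
    refine mul_nonpos_of_nonneg_of_nonpos hv (sub_nonpos.2 ?_)
    gcongr
  have hθhigh : ∀ v, u ≤ v → 0 ≤ θ v := fun v hv => by
    rw [hθfac]
    refine mul_nonneg (hu0.le.trans hv) (sub_nonneg.2 ?_)
    gcongr
  -- Both `θ(F)` and `g - c (1 - F)` go from nonpositive to nonnegative at `t₀`, so their product is
  -- nonnegative.
  have hpt : ∀ t, c * (θ (cdf ν t) * (1 - cdf ν t)) ≤ θ (cdf ν t) * g t := by
    intro t
    rcases le_total t t₀ with ht | ht
    · have h1 := hθlow _ (cdf_nonneg ν t) ((monotone_cdf ν ht).trans ht₀.le)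
      nlinarith [hlow t ht]
    · have h1 := hθhigh _ (ht₀.ge.trans (monotone_cdf ν ht))
      nlinarith [hhigh t ht]
  obtain ⟨C, hC⟩ := isCompact_Icc.exists_bound_of_continuousOn (s := Set.Icc (0 : ℝ) 1)
    hθc.continuousOn
  have hgint : Integrable g := by
    refine ⟨hg.aestronglyMeasurable, ?_⟩
    rw [hasFiniteIntegral_iff_ofReal (ae_of_all _ hg0)]
    have h1 : ν Set.univ = ∫⁻ t, ENNReal.ofReal (g t) := by
      conv_lhs => rw [hν]
      rw [withDensity_apply _ MeasurableSet.univ, Measure.restrict_univ]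
    rw [← h1]
    exact measure_lt_top _ _
  have hθg : Integrable fun t => θ (cdf ν t) * g t :=
    hgint.bdd_mul (hθc.measurable.comp measurable_cdf).aestronglyMeasurable
      (ae_of_all _ fun t => hC _ ⟨cdf_nonneg ν t, cdf_le_one ν t⟩)
  have hzero : ∫ t, θ (cdf ν t) * g t = 0 := by
    have h1 : ∫ t, θ (cdf ν t) ∂ν = ∫ t, θ (cdf ν t) * g t := by
      set F := cdf ν
      rw [hν, integral_withDensity_eq_integral_toReal_smul hg.ennreal_ofReal
        (ae_of_all _ fun _ => ENNReal.ofReal_lt_top)]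
      refine integral_congr_ae (ae_of_all _ fun t => ?_)
      simp only [ENNReal.toReal_ofReal (hg0 t), smul_eq_mul]
      ring
    rw [← h1, integral_comp_cdf hθc.measurable]
    simp only [hθ]
    rw [intervalIntegral.integral_sub (Continuous.intervalIntegrable (by fun_prop) _ _)
        (Continuous.intervalIntegrable (by fun_prop) _ _),
      intervalIntegral.integral_const_mul, intervalIntegral.integral_const_mul, integral_pow,
      integral_id]
    have hn1 : ((n - 1 : ℕ) : ℝ) + 1 = n := by
      rw [Nat.cast_sub (by omega)]; push_cast; ring
    rw [hn1, one_pow, zero_pow (by omega)]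
    field_simp
    norm_num
  -- `θ(F)` vanishes on the negative half-line, so `hzero` is in fact about the integral over `Ioi
  -- 0`.
  have hneg : ∀ t ≤ (0 : ℝ), cdf ν t = 0 := fun t ht => by
    rw [cdf_eq_real, measureReal_def]
    have : ν (Set.Iic t) = 0 := by
      rw [← Iio_ae_eq_Iic.measure_eq]
      exact measure_mono_null (Set.Iio_subset_Iio ht) hpos
    rw [this, ENNReal.toReal_zero]
  have hcomp : c * ∫ t in Set.Ioi 0, θ (cdf ν t) * (1 - cdf ν t) ≤ 0 := by
    rw [← setIntegral_eq_integral_of_forall_compl_eq_zero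
      (s := Set.Ioi 0) (f := fun t => θ (cdf ν t) * g t)] at hzero
    · rw [← integral_const_mul]
      refine le_of_le_of_eq ?_ hzero
      exact setIntegral_mono ((integrableOn_comp_cdf_mul hpos hint hθc).const_mul c)
        hθg.integrableOn hpt
    · intro t ht
      rw [hneg t (not_lt.1 ht)]
      simp [hθ, zero_pow (show n - 1 ≠ 0 by omega)]
  have hle : ∫ t in Set.Ioi 0, θ (cdf ν t) * (1 - cdf ν t) ≤ 0 := by
    by_contra! hlt
    exact absurd hcomp (mul_pos hc hlt).not_ge
  have hsub : ∫ t in Set.Ioi 0, θ (cdf ν t) * (1 - cdf ν t) =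
      (∫ t in Set.Ioi 0, n * cdf ν t ^ (n - 1) * (1 - cdf ν t)) -
        ∫ t in Set.Ioi 0, 2 * cdf ν t * (1 - cdf ν t) := by
    rw [← integral_sub
      (integrableOn_comp_cdf_mul hpos hint (φ := fun v => n * v ^ (n - 1)) (by fun_prop))
      (integrableOn_comp_cdf_mul hpos hint (φ := fun v => 2 * v) (by fun_prop))]
    refine integral_congr_ae (ae_of_all _ fun t => ?_)
    simp only [hθ]
    ring
  linarith

/-- The Gini mean difference is twice the mean of `y (2 F(y) - 1)`. -/
theorem integral_cdf_mul_one_sub_cdf [NullSingletonClass ν] (hpos : ν (Set.Iio 0) = 0)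
    (h : Integrable id ν) :
    ∫ t in Set.Ioi 0, cdf ν t * (1 - cdf ν t) = ∫ s, s * (2 * cdf ν s - 1) ∂ν := by
  have hFm : Measurable (cdf ν) := measurable_cdf
  set q : ℝ → ℝ := fun s => 2 * cdf ν s - 1 with hq
  have hqm : Measurable q := (hFm.const_mul 2).sub_const 1
  have hq1 : ∀ s, |q s| ≤ 1 := fun s => by
    rw [abs_le]
    constructor <;> simp only [hq] <;> linarith [cdf_nonneg ν s, cdf_le_one ν s]
  -- This is `∫ (2v - 1) dv` from `F(t)` to `1`.
  have hinner : ∀ t, ∫ s in Set.Ioi t, q s ∂ν = cdf ν t * (1 - cdf ν t) := fun t => by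
    rw [setIntegral_Ioi_comp_cdf (φ := fun v => 2 * v - 1) (by fun_prop),
      intervalIntegral.integral_sub (Continuous.intervalIntegrable (by fun_prop) _ _)
        (Continuous.intervalIntegrable (by fun_prop) _ _),
      intervalIntegral.integral_const_mul, integral_id, intervalIntegral.integral_const]
    simp only [smul_eq_mul]
    ring
  -- The kernel `q(s)` on `t < s`: integrating first in `s` gives `F(t) (1 - F(t))`, first in `t >
  -- 0` gives `s q(s)`.
  set k : ℝ → ℝ → ℝ := fun t s => {p : ℝ × ℝ | p.1 < p.2}.indicator (fun p => q p.2) (t, s) with hk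
  have hkm : Measurable (Function.uncurry k) :=
    (hqm.comp measurable_snd).indicator (measurableSet_lt measurable_fst measurable_snd)
  have hk1 : ∀ t, (fun s => k t s) = (Set.Ioi t).indicator q := fun t => by
    ext s; simp [hk, Set.indicator]
  have hk2 : ∀ s, (fun t => k t s) = (Set.Iio s).indicator fun _ => q s := fun s => by
    ext t; simp [hk, Set.indicator]
  have hvol : ∀ s, 0 ≤ s → (volume.restrict (Set.Ioi (0 : ℝ))) (Set.Iio s) = ENNReal.ofReal s := by
    intro s _
    rw [Measure.restrict_apply measurableSet_Iio, Set.inter_comm, Set.Ioi_inter_Iio,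
      Real.volume_Ioo, sub_zero]
  have hae : ∀ᵐ s ∂ν, (0 : ℝ) ≤ s := by
    rw [ae_iff]; simpa [Set.Iio] using hpos
  have hkint : Integrable (Function.uncurry k) ((volume.restrict (Set.Ioi (0 : ℝ))).prod ν) := by
    rw [integrable_prod_iff' hkm.aestronglyMeasurable]
    constructor
    · filter_upwards [hae] with s hs
      show Integrable (fun t => k t s) _
      rw [hk2, integrable_indicator_iff measurableSet_Iio]
      refine integrableOn_const ?_
      rw [hvol s hs]
      exact ENNReal.ofReal_ne_top
    · refine h.mono (by exact
        (hkm.norm.stronglyMeasurable.integral_prod_left').aestronglyMeasurable) ?_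
      filter_upwards [hae] with s hs
      have h1 : (fun t => ‖Function.uncurry k (t, s)‖) = (Set.Iio s).indicator fun _ => |q s| := by
        ext t
        show ‖(fun t => k t s) t‖ = _
        rw [hk2, norm_indicator_eq_indicator_norm]; rfl
      rw [h1, integral_indicator_const _ measurableSet_Iio, measureReal_def, hvol s hs,
        ENNReal.toReal_ofReal hs, smul_eq_mul, norm_mul, id, Real.norm_eq_abs |q s|, abs_abs]
      exact mul_le_of_le_one_right (norm_nonneg _) (hq1 s)
  calc ∫ t in Set.Ioi 0, cdf ν t * (1 - cdf ν t)
      = ∫ t in Set.Ioi 0, ∫ s, k t s ∂ν := by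
        refine integral_congr_ae (ae_of_all _ fun t => ?_)
        simp only
        rw [hk1, integral_indicator measurableSet_Ioi, hinner]
    _ = ∫ s, (∫ t in Set.Ioi 0, k t s) ∂ν := integral_integral_swap hkint
    _ = ∫ s, s * q s ∂ν := by
        refine integral_congr_ae ?_
        filter_upwards [hae] with s hs
        rw [hk2, integral_indicator_const _ measurableSet_Iio, measureReal_def, hvol s hs,
          ENNReal.toReal_ofReal hs, smul_eq_mul]

/-- The Gini mean difference of an atomless law on the half-line is at most `2 / √3` times the
standard deviation. -/
theorem integral_gini_le_sqrt_variance [NullSingletonClass ν] (hpos : ν (Set.Iio 0) = 0)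
    (h : MemLp id 2 ν) :
    ∫ t in Set.Ioi 0, 2 * cdf ν t * (1 - cdf ν t) ≤ √(4 / 3 * variance id ν) := by
  have hFm : Measurable (cdf ν) := measurable_cdf
  have hint : Integrable id ν := h.integrable one_le_two
  set q : ℝ → ℝ := fun s => 2 * cdf ν s - 1 with hq
  have hqm : Measurable q := (hFm.const_mul 2).sub_const 1
  have hq1 : ∀ s, |q s| ≤ 1 := fun s => by
    rw [abs_le]
    constructor <;> simp only [hq] <;> linarith [cdf_nonneg ν s, cdf_le_one ν s]
  have hqL : MemLp q 2 ν := (memLp_top_of_bound hqm.aestronglyMeasurable 1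
    (ae_of_all _ hq1)).mono_exponent le_top
  have hqmean : ∫ s, q s ∂ν = 0 := by
    rw [integral_comp_cdf (φ := fun v => 2 * v - 1) (by fun_prop),
      intervalIntegral.integral_sub (Continuous.intervalIntegrable (by fun_prop) _ _)
        (Continuous.intervalIntegrable (by fun_prop) _ _),
      intervalIntegral.integral_const_mul, integral_id, intervalIntegral.integral_const]
    norm_num
  have hqsq : ∫ s, q s ^ 2 ∂ν = 1 / 3 := by
    rw [integral_comp_cdf (φ := fun v => (2 * v - 1) ^ 2) (by fun_prop)]
    have : ∀ v : ℝ, (2 * v - 1) ^ 2 = 4 * v ^ 2 - (4 * v - 1) := fun v => by ring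
    simp only [this]
    rw [intervalIntegral.integral_sub (Continuous.intervalIntegrable (by fun_prop) _ _)
        (Continuous.intervalIntegrable (by fun_prop) _ _),
      intervalIntegral.integral_sub (Continuous.intervalIntegrable (by fun_prop) _ _)
        (Continuous.intervalIntegrable (by fun_prop) _ _),
      intervalIntegral.integral_const_mul, intervalIntegral.integral_const_mul, integral_pow,
      integral_id, intervalIntegral.integral_const]
    norm_num
  set μ := ∫ s, s ∂ν with hμ
  set A : ℝ → ℝ := fun s => s - μ with hA
  have hAL : MemLp A 2 ν := h.sub (memLp_const μ)
  set m := ∫ s, A s * q s ∂ν with hm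
  have hAq : Integrable (fun s => A s * q s) ν := hAL.integrable_mul hqL
  have hA2 : Integrable (fun s => A s ^ 2) ν := hAL.integrable_sq
  have hq2 : Integrable (fun s => q s ^ 2) ν := hqL.integrable_sq
  have hvar : variance id ν = ∫ s, A s ^ 2 ∂ν :=
    variance_eq_integral measurable_id.aemeasurable
  have hm' : ∫ t in Set.Ioi 0, cdf ν t * (1 - cdf ν t) = m := by
    rw [integral_cdf_mul_one_sub_cdf hpos hint]
    have h1 : Integrable (fun s => s * q s) ν := h.integrable_mul hqL
    have h2 : Integrable (fun s => μ * q s) ν := (hqL.integrable one_le_two).const_mul μ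
    have h3 : m = ∫ s, (s * q s - μ * q s) ∂ν :=
      integral_congr_ae (ae_of_all _ fun s => by simp only [hA]; ring)
    rw [h3, integral_sub h1 h2, integral_const_mul, hqmean, mul_zero, sub_zero]
  -- Cauchy–Schwarz: `3 m` is the regression coefficient of `A` on `q`, since `q` has second moment
  -- `1/3`.
  have hsq : 0 ≤ variance id ν - 3 * m ^ 2 := by
    have h1 : 0 ≤ ∫ s, (A s - 3 * m * q s) ^ 2 ∂ν := integral_nonneg fun s => sq_nonneg _
    have h2 : ∫ s, (A s - 3 * m * q s) ^ 2 ∂ν =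
        ∫ s, (A s ^ 2 - 6 * m * (A s * q s) + 9 * m ^ 2 * q s ^ 2) ∂ν :=
      integral_congr_ae (ae_of_all _ fun s => by ring)
    have h3 : Integrable (fun s => A s ^ 2 - 6 * m * (A s * q s)) ν := hA2.sub (hAq.const_mul _)
    rw [h2, integral_add h3 (hq2.const_mul _), integral_sub hA2 (hAq.const_mul _), integral_const_mul, integral_const_mul, hqsq,
      ← hvar, ← hm] at h1
    linarith
  have h2m : ∫ t in Set.Ioi 0, 2 * cdf ν t * (1 - cdf ν t) = 2 * m := by
    rw [← hm', ← integral_const_mul]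
    exact integral_congr_ae (ae_of_all _ fun t => by ring)
  rw [h2m]
  exact Real.le_sqrt_of_sq_le (by linarith)

end MonotoneHazardRate

/-! ### The law of an agent's best solution, and the expected loss of the mechanism. -/

section Best

variable {Ω : Type u} [MeasurableSpace Ω] {x : Ω → ℝ} {k : ℕ} {P : Measure Ω}

theorem measurable_iSup_comp (hx : Measurable x) :
    Measurable fun w : Fin k → Ω => ⨆ j, x (w j) :=
  Measurable.iSup fun j => hx.comp (measurable_pi_apply j)

theorem isProbabilityMeasure_bestLaw [IsProbabilityMeasure P] (hx : Measurable x) :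
    IsProbabilityMeasure (bestLaw x k P) :=
  Measure.isProbabilityMeasure_map (measurable_iSup_comp hx).aemeasurable

theorem cdf_bestLaw [IsProbabilityMeasure P] (hx : Measurable x) (hk : 1 ≤ k) (t : ℝ) :
    cdf (bestLaw x k P) t = cdf (P.map x) t ^ k := by
  have := isProbabilityMeasure_bestLaw (k := k) (P := P) hx
  have := Measure.isProbabilityMeasure_map (μ := P) hx.aemeasurable
  have : Nonempty (Fin k) := ⟨⟨0, hk⟩⟩
  have hset : (fun w : Fin k → Ω => ⨆ j, x (w j)) ⁻¹' Set.Iic t =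
      Set.univ.pi fun _ => x ⁻¹' Set.Iic t := by
    ext w
    simp [ciSup_le_iff (Set.finite_range _).bddAbove]
  rw [cdf_eq_real, cdf_eq_real, measureReal_def, measureReal_def, bestLaw,
    Measure.map_apply (measurable_iSup_comp hx) measurableSet_Iic, hset, Measure.pi_pi,
    Measure.map_apply hx measurableSet_Iic]
  simp

theorem bestLaw_Iio_zero (hx : Measurable x) (hx_pos : ∀ w, 0 < x w) :
    bestLaw x k P (Set.Iio 0) = 0 := by
  have hset : (fun w : Fin k → Ω => ⨆ j, x (w j)) ⁻¹' Set.Iio 0 = ∅ := by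
    rw [Set.eq_empty_iff_forall_notMem]
    intro w hw
    exact absurd (Real.iSup_nonneg fun j => (hx_pos (w j)).le) (not_le.2 hw)
  rw [bestLaw, Measure.map_apply (measurable_iSup_comp hx) measurableSet_Iio, hset, measure_empty]

/-- Independence of the agents' best values, each with law `bestLaw`. -/
theorem solutionLaw_forall_mem [IsProbabilityMeasure P] (hx : Measurable x) {n : ℕ}
    {A : Fin n → Set ℝ} (hA : ∀ i, MeasurableSet (A i)) :
    solutionLaw n k P {ω | ∀ i, ⨆ j, x (ω i j) ∈ A i} = ∏ i, bestLaw x k P (A i) := by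
  have hset : {ω : Fin n → Fin k → Ω | ∀ i, ⨆ j, x (ω i j) ∈ A i} =
      Set.univ.pi fun i => (fun w : Fin k → Ω => ⨆ j, x (w j)) ⁻¹' A i := by
    ext ω; simp
  rw [hset, solutionLaw, Measure.pi_pi]
  exact Finset.prod_congr rfl fun i _ =>
    (Measure.map_apply (measurable_iSup_comp hx) (hA i)).symm

/-- A bound on the maximum of finitely many numbers by the second largest and the measure of the
levels that only one of them exceeds. -/
theorem ofReal_iSup_le_add_lintegral {n : ℕ} (hn : 2 ≤ n) (b : Fin n → ℝ) (v : ℝ≥0∞)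
    (hv : ∀ i j, i ≠ j → ENNReal.ofReal (min (b i) (b j)) ≤ v) :
    ENNReal.ofReal (⨆ i, b i) ≤ v + ∫⁻ t in Set.Ioi (0 : ℝ),
      ∑ i, {p : ℝ × (Fin n → ℝ) | p.1 < p.2 i ∧ ∀ j ≠ i, p.2 j ≤ p.1}.indicator 1 (t, b) := by
  rcases eq_or_ne v ∞ with rfl | hvt
  · simp
  obtain ⟨r, hr, rfl⟩ : ∃ r : ℝ, 0 ≤ r ∧ ENNReal.ofReal r = v :=
    ⟨v.toReal, ENNReal.toReal_nonneg, ENNReal.ofReal_toReal hvt⟩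
  have : Nonempty (Fin n) := ⟨⟨0, by omega⟩⟩
  obtain ⟨m, hm⟩ := exists_eq_ciSup_of_finite (f := b)
  have hmax : ∀ j, b j ≤ b m := fun j => by
    rw [hm]; exact le_ciSup (Set.finite_range b).bddAbove j
  rw [← hm]
  calc ENNReal.ofReal (b m) = ENNReal.ofReal (r + (b m - r)) := by ring_nf
    _ ≤ ENNReal.ofReal r + ENNReal.ofReal (b m - r) := ENNReal.ofReal_add_le
    _ ≤ _ := by
      gcongr
      have hsub : Set.Ioo r (b m) ⊆ Set.Ioi 0 := fun t ht => hr.trans_lt ht.1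
      -- The excess over `r` is the length of `(r, b m)`, and at these levels `m` alone is above,
      -- because every other `b j` is at most `r`.
      rw [← Real.volume_Ioo, ← Set.inter_eq_left.2 hsub,
        ← Measure.restrict_apply measurableSet_Ioo, ← lintegral_indicator_one measurableSet_Ioo]
      refine lintegral_mono fun t => ?_
      by_cases ht : t ∈ Set.Ioo r (b m)
      · rw [Set.indicator_of_mem ht]
        refine le_trans ?_ (Finset.single_le_sum (fun i _ => zero_le) (Finset.mem_univ m))
        rw [Set.indicator_of_mem]
        · rfl
        · refine ⟨ht.2, fun j hj => ?_⟩
          have h1 := hv m j hj.symm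
          rw [min_eq_right (hmax j), ENNReal.ofReal_le_ofReal_iff hr] at h1
          exact h1.trans ht.1.le
      · rw [Set.indicator_of_notMem ht]
        exact zero_le

/-- The mechanism loses at most the expected gap between the two best agents. -/
theorem hasAdditivePoA_singleProposal [IsProbabilityMeasure P] (hx : Measurable x)
    (hx_pos : ∀ w, 0 < x w) {n : ℕ} (hn : 2 ≤ n) (rank : Equiv.Perm (Fin n)) (hk : 1 ≤ k)
    (y : Fin n → Ω → ℝ) (hy : ∀ i w, 0 < y i w) (hint : Integrable id (bestLaw x k P)) {γ : ℝ}
    (hγ : ∫ t in Set.Ioi 0,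
      n * cdf (bestLaw x k P) t ^ (n - 1) * (1 - cdf (bestLaw x k P) t) ≤ γ) :
    (singleProposal x (fun _ => Set.univ) rank).HasAdditivePoA x y k P γ := by
  intro σ hσ
  have hprob := isProbabilityMeasure_bestLaw (k := k) (P := P) hx
  have : IsProbabilityMeasure (solutionLaw n k P) := by unfold solutionLaw; infer_instance
  have : Nonempty (Fin k) := ⟨⟨0, hk⟩⟩
  set ν := bestLaw x k P with hν
  set E : Fin n → Set (ℝ × (Fin n → ℝ)) :=
    fun i => {p | p.1 < p.2 i ∧ ∀ j ≠ i, p.2 j ≤ p.1} with hE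
  have hEm : ∀ i, MeasurableSet (E i) := fun i => by
    have h2 : ∀ j, Measurable fun p : ℝ × (Fin n → ℝ) => p.2 j := fun j =>
      (measurable_pi_apply j).comp measurable_snd
    refine (measurableSet_lt measurable_fst (h2 i)).inter ?_
    have : {p : ℝ × (Fin n → ℝ) | ∀ j ≠ i, p.2 j ≤ p.1} =
        ⋂ j, ⋂ _ : j ≠ i, {p | p.2 j ≤ p.1} := by ext; simp
    change MeasurableSet {p : ℝ × (Fin n → ℝ) | ∀ j ≠ i, p.2 j ≤ p.1}
    rw [this]
    exact MeasurableSet.iInter fun j => MeasurableSet.iInter fun _ =>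
      measurableSet_le (h2 j) measurable_fst
  have hBm : Measurable fun ω : Fin n → Fin k → Ω => fun i => ⨆ j, x (ω i j) :=
    measurable_pi_lambda _ fun i => (measurable_iSup_comp hx).comp (measurable_pi_apply i)
  -- Indicates that exactly one agent has a best value above `t`; its integral over `t > 0` is the
  -- gap between the two best agents.
  set Φ : (Fin n → Fin k → Ω) → ℝ → ℝ≥0∞ :=
    fun ω t => ∑ i, (E i).indicator 1 (t, fun i => ⨆ j, x (ω i j)) with hΦ
  have hΦm : Measurable (Function.uncurry Φ) :=
    Finset.measurable_sum _ fun i _ => (measurable_one.indicator (hEm i)).comp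
      (measurable_snd.prodMk (hBm.comp measurable_fst))
  have hpt : ∀ ω, ENNReal.ofReal (⨆ i, ⨆ j, x (ω i j)) ≤
      (singleProposal x (fun _ => Set.univ) rank).expect (principalValue x) (σ ω) +
        ∫⁻ t in Set.Ioi (0 : ℝ), Φ ω t := fun ω => by
    refine ofReal_iSup_le_add_lintegral hn (fun i => ⨆ j, x (ω i j)) _ fun i j hij => ?_
    obtain ⟨l, hl⟩ := exists_eq_ciSup_of_finite (f := fun l => x (ω i l))
    obtain ⟨m, hm⟩ := exists_eq_ciSup_of_finite (f := fun l => x (ω j l))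
    rw [← hl, ← hm]
    exact min_le_expect_principalValue x rank y hy ω (σ ω) (hσ ω) hij l m
  have hslice : ∀ t, ∫⁻ ω, Φ ω t ∂(solutionLaw n k P) =
      ENNReal.ofReal (n * cdf ν t ^ (n - 1) * (1 - cdf ν t)) := fun t => by
    have hone : ∀ i, ∫⁻ ω, (E i).indicator 1 (t, fun i => ⨆ j, x (ω i j)) ∂(solutionLaw n k P) =
        ENNReal.ofReal (cdf ν t ^ (n - 1) * (1 - cdf ν t)) := fun i => by
      have hpre : MeasurableSet ((fun ω : Fin n → Fin k → Ω =>
          (t, fun i => ⨆ j, x (ω i j))) ⁻¹' E i) := (measurable_const.prodMk hBm) (hEm i)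
      have hset : ((fun ω : Fin n → Fin k → Ω => (t, fun i => ⨆ j, x (ω i j))) ⁻¹' E i) =
          {ω | ∀ m, ⨆ j, x (ω m j) ∈ if m = i then Set.Ioi t else Set.Iic t} := by
        ext ω
        simp only [hE, Set.mem_preimage, Set.mem_ofPred_eq]
        constructor
        · rintro ⟨h1, h2⟩ m
          split_ifs with hm
          · rw [hm]; exact h1
          · exact h2 m hm
        · intro h
          refine ⟨by simpa using h i, fun j hj => ?_⟩
          have := h j
          rwa [if_neg hj] at this
      calc _ = ∫⁻ ω, ((fun ω : Fin n → Fin k → Ω =>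
              (t, fun i => ⨆ j, x (ω i j))) ⁻¹' E i).indicator 1 ω ∂(solutionLaw n k P) := rfl
        _ = ∏ m, ν (if m = i then Set.Ioi t else Set.Iic t) := by
            rw [lintegral_indicator_one hpre, hset, solutionLaw_forall_mem hx]
            intro m
            split_ifs
            exacts [measurableSet_Ioi, measurableSet_Iic]
        _ = ν (Set.Ioi t) * ν (Set.Iic t) ^ (n - 1) := by
            rw [← Finset.mul_prod_erase _ _ (Finset.mem_univ i), if_pos rfl,
              Finset.prod_congr rfl fun m hm => by rw [if_neg (Finset.ne_of_mem_erase hm)],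
              Finset.prod_const, Finset.card_erase_of_mem (Finset.mem_univ i), Finset.card_univ,
              Fintype.card_fin]
        _ = _ := by
            rw [← ofReal_measureReal (measure_ne_top ν (Set.Ioi t)), ← one_sub_cdf, ← ofReal_cdf,
              mul_comm, ← ENNReal.ofReal_pow (cdf_nonneg ν t),
              ← ENNReal.ofReal_mul (pow_nonneg (cdf_nonneg ν t) _)]
    simp only [hΦ]
    rw [lintegral_finsetSum]
    · simp only [hone]
      rw [Finset.sum_const, Finset.card_univ, Fintype.card_fin, nsmul_eq_mul,
        ← ENNReal.ofReal_natCast, ← ENNReal.ofReal_mul (Nat.cast_nonneg n), mul_assoc]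
    · intro i _
      exact (measurable_one.indicator (hEm i)).comp (measurable_const.prodMk hBm)
  calc opt n x k P
      ≤ ∫⁻ ω, ((singleProposal x (fun _ => Set.univ) rank).expect (principalValue x) (σ ω) +
          ∫⁻ t in Set.Ioi (0 : ℝ), Φ ω t) ∂(solutionLaw n k P) := lintegral_mono hpt
    _ = (∫⁻ ω, (singleProposal x (fun _ => Set.univ) rank).expect (principalValue x) (σ ω)
          ∂(solutionLaw n k P)) +
        ∫⁻ ω, (∫⁻ t in Set.Ioi (0 : ℝ), Φ ω t) ∂(solutionLaw n k P) :=
        -- Only the gap term has to be measurable here, so `σ` may be arbitrary.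
        lintegral_add_right _ hΦm.lintegral_prod_right
    _ ≤ _ := by
      gcongr
      rw [lintegral_lintegral_swap hΦm.aemeasurable]
      simp only [hslice]
      rw [← ofReal_integral_eq_lintegral_ofReal
        (integrableOn_comp_cdf_mul (bestLaw_Iio_zero hx hx_pos) hint
          (φ := fun v => n * v ^ (n - 1)) (by fun_prop))]
      · exact ENNReal.ofReal_le_ofReal hγ
      · refine ae_of_all _ fun t => ?_
        have h1 := cdf_nonneg ν t
        have h2 := sub_nonneg.2 (cdf_le_one ν t)
        positivity

theorem hasMHR_bestLaw [IsProbabilityMeasure P] (hx : Measurable x) (hk : 1 ≤ k)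
    (h : HasMHR (P.map x)) : HasMHR (bestLaw x k P) := by
  have := isProbabilityMeasure_bestLaw (k := k) (P := P) hx
  have := Measure.isProbabilityMeasure_map (μ := P) hx.aemeasurable
  exact h.of_cdf_eq_pow hk (cdf_bestLaw hx hk)

theorem memLp_two_bestLaw [IsProbabilityMeasure P] (hx : Measurable x) (hx_pos : ∀ w, 0 < x w)
    (hk : 1 ≤ k) (h : HasMHR (P.map x)) : MemLp id 2 (bestLaw x k P) := by
  have := isProbabilityMeasure_bestLaw (k := k) (P := P) hx
  exact memLp_two_of_hasMHR (hasMHR_bestLaw hx hk h) (bestLaw_Iio_zero hx hx_pos)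

theorem hasAdditivePoA_of_hasMHR [IsProbabilityMeasure P] (hx : Measurable x)
    (hx_pos : ∀ w, 0 < x w) {n : ℕ} (hn : 2 ≤ n) (rank : Equiv.Perm (Fin n)) (hk : 1 ≤ k)
    (y : Fin n → Ω → ℝ) (hy : ∀ i w, 0 < y i w) (h : HasMHR (P.map x)) :
    (singleProposal x (fun _ => Set.univ) rank).HasAdditivePoA x y k P
      (√(4 / 3 * variance id (bestLaw x k P))) := by
  have := isProbabilityMeasure_bestLaw (k := k) (P := P) hx
  have hbest := hasMHR_bestLaw hx hk h
  have := nullSingletonClass_of_hasMHR hbest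
  have hmem := memLp_two_bestLaw hx hx_pos hk h
  have h0 := bestLaw_Iio_zero (k := k) (P := P) hx hx_pos
  exact hasAdditivePoA_singleProposal hx hx_pos hn rank hk y hy (hmem.integrable one_le_two)
    ((integral_gap_le_of_hasMHR hbest h0 hn).trans (integral_gini_le_sqrt_variance h0 hmem))

end Best

/-! ### The uniform law. -/

section Uniform

instance isProbabilityMeasure_uniform :
    IsProbabilityMeasure (volume.restrict (Set.Icc (0 : ℝ) 1)) := ⟨by simp⟩

theorem cdf_uniform (t : ℝ) :
    cdf (volume.restrict (Set.Icc (0 : ℝ) 1)) t = max (min t 1) 0 := by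
  have h : Set.Iic t ∩ Set.Icc (0 : ℝ) 1 = Set.Icc 0 (min t 1) := by
    ext s; simp only [Set.mem_inter_iff, Set.mem_Iic, Set.mem_Icc, le_min_iff]; tauto
  rw [cdf_eq_real, measureReal_restrict_apply measurableSet_Iic, h, Real.volume_real_Icc, sub_zero]

/-- The hazard rate is `0` on the negatives and `1 / (1 - t)` on `[0,1)`. The drop of the density to
`0` after `1` lies outside the set where the c.d.f. is below one. -/
theorem hasMHR_uniform : HasMHR (volume.restrict (Set.Icc (0 : ℝ) 1)) := by
  refine ⟨(Set.Icc (0 : ℝ) 1).indicator 1, measurable_one.indicator measurableSet_Icc,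
    fun t => Set.indicator_nonneg (fun _ _ => zero_le_one) t, ?_, ?_⟩
  · rw [← withDensity_indicator_one measurableSet_Icc]
    congr 1
    ext t
    by_cases ht : t ∈ Set.Icc (0 : ℝ) 1 <;> simp [ht]
  · intro s hs t ht hst
    have hs1 : cdf (volume.restrict (Set.Icc (0 : ℝ) 1)) s < 1 := hs
    have ht1 : cdf (volume.restrict (Set.Icc (0 : ℝ) 1)) t < 1 := ht
    have hst' := monotone_cdf (volume.restrict (Set.Icc (0 : ℝ) 1)) hst
    have htlt : t < 1 := by
      by_contra! h
      rw [cdf_uniform, min_eq_right h] at ht1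
      norm_num at ht1
    show _ / _ ≤ _ / _
    refine div_le_div₀ (Set.indicator_nonneg (fun _ _ => zero_le_one) t) ?_ (sub_pos.2 ht1)
      (by linarith)
    by_cases hs0 : s ∈ Set.Icc (0 : ℝ) 1
    · have ht0 : t ∈ Set.Icc (0 : ℝ) 1 := ⟨hs0.1.trans hst, htlt.le⟩
      rw [Set.indicator_of_mem hs0, Set.indicator_of_mem ht0]
      rfl
    · rw [Set.indicator_of_notMem hs0]
      exact Set.indicator_nonneg (fun _ _ => zero_le_one) t

/-- The density is `k s^(k-1)` on the unit interval; the variance needs `m = 1` and `m = 2`. -/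
theorem integral_pow_of_cdf_eq_uniform_pow {ν : Measure ℝ} [IsProbabilityMeasure ν] {k : ℕ}
    (hk : 1 ≤ k) (h : ∀ t, cdf ν t = cdf (volume.restrict (Set.Icc (0 : ℝ) 1)) t ^ k) (m : ℕ) :
    ∫ s, s ^ m ∂ν = k / (k + m) := by
  have hm : Measurable fun t => ENNReal.ofReal
      (k * cdf (volume.restrict (Set.Icc (0 : ℝ) 1)) t ^ (k - 1)) :=
    (measurable_const.mul (measurable_cdf.pow_const _)).ennreal_ofReal
  rw [eq_withDensity_of_cdf_eq_pow hk h, integral_withDensity_eq_integral_toReal_smul hm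
    (ae_of_all _ fun _ => ENNReal.ofReal_lt_top)]
  have hcongr : ∫ s in Set.Icc (0 : ℝ) 1, (ENNReal.ofReal
      (k * cdf (volume.restrict (Set.Icc (0 : ℝ) 1)) s ^ (k - 1))).toReal • s ^ m =
      ∫ s in Set.Icc (0 : ℝ) 1, k * s ^ (k - 1 + m) := by
    refine setIntegral_congr_fun measurableSet_Icc fun s hs => ?_
    have := hs.1
    simp only [cdf_uniform, min_eq_left hs.2, max_eq_left hs.1, smul_eq_mul]
    rw [ENNReal.toReal_ofReal (by positivity), pow_add, mul_assoc]
  rw [hcongr, integral_Icc_eq_integral_Ioc, ← intervalIntegral.integral_of_le zero_le_one,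
    intervalIntegral.integral_const_mul, integral_pow, one_pow, zero_pow (by omega), sub_zero]
  have hk' : ((k - 1 + m : ℕ) : ℝ) + 1 = k + m := by
    push_cast [Nat.cast_sub hk]; ring
  rw [hk', mul_one_div]

theorem variance_of_cdf_eq_uniform_pow {ν : Measure ℝ} [IsProbabilityMeasure ν] {k : ℕ}
    (hk : 1 ≤ k) (h : ∀ t, cdf ν t = cdf (volume.restrict (Set.Icc (0 : ℝ) 1)) t ^ k)
    (hmem : MemLp id 2 ν) : variance id ν = k / ((k + 1) ^ 2 * (k + 2)) := by
  have h1 := integral_pow_of_cdf_eq_uniform_pow hk h 1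
  have h2 := integral_pow_of_cdf_eq_uniform_pow hk h 2
  simp only [pow_one] at h1
  rw [variance_eq_sub hmem]
  simp only [Pi.pow_apply, id]
  rw [h1, h2]
  have hkpos : (0 : ℝ) ≤ k := Nat.cast_nonneg k
  push_cast
  field_simp
  ring

end Uniform

/-! ### Size and asymptotics of the uniform bound. -/

section Numerics

theorem sqrt_uniform_bound_le (k : ℕ) (hk : 1 ≤ k) :
    √(4 * (k : ℝ) / (3 * ((k : ℝ) + 1) ^ 2 * ((k : ℝ) + 2))) ≤ 1.155 / (k : ℝ) := by
  have hk' : (0 : ℝ) < k := by exact_mod_cast hk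
  refine Real.sqrt_le_iff.2 ⟨by positivity, ?_⟩
  rw [div_pow, div_le_div_iff₀ (by positivity) (by positivity)]
  -- The leading coefficients decide: `3 · 1.155² = 4.002… ≥ 4`.
  nlinarith [pow_pos hk' 2, pow_pos hk' 3]

theorem tendsto_mul_sqrt_uniform_bound :
    Tendsto (fun k : ℕ =>
      (k : ℝ) * √(4 * (k : ℝ) / (3 * ((k : ℝ) + 1) ^ 2 * ((k : ℝ) + 2)))) atTop
      (𝓝 (2 / √3)) := by
  have hinv : Tendsto (fun k : ℕ => (1 : ℝ) / k) atTop (𝓝 0) := tendsto_one_div_atTop_nhds_zero_nat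
  have hlim : Tendsto (fun k : ℕ => √(4 / (3 * (1 + 1 / (k : ℝ)) ^ 2 * (1 + 2 * (1 / (k : ℝ))))))
      atTop (𝓝 √(4 / (3 * (1 + 0) ^ 2 * (1 + 2 * 0)))) := by
    refine (Real.continuous_sqrt.tendsto _).comp (Tendsto.div tendsto_const_nhds ?_ (by norm_num))
    exact (((hinv.const_add 1).pow 2).const_mul 3).mul ((hinv.const_mul 2).const_add 1)
  have hval : √(4 / (3 * (1 + 0) ^ 2 * (1 + 2 * 0)) : ℝ) = 2 / √3 := by
    rw [show (4 / (3 * (1 + 0) ^ 2 * (1 + 2 * 0)) : ℝ) = 2 ^ 2 / 3 by norm_num,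
      Real.sqrt_div (by norm_num), Real.sqrt_sq (by norm_num)]
  rw [hval] at hlim
  refine hlim.congr' ?_
  filter_upwards [eventually_ge_atTop 1] with k hk
  have hk' : (0 : ℝ) < k := by exact_mod_cast hk
  rw [← Real.sqrt_sq hk'.le, ← Real.sqrt_mul (by positivity), Real.sqrt_sq hk'.le]
  congr 1
  field_simp

theorem abs_two_div_sqrt_three_sub_lt : |2 / √3 - (1.155 : ℝ)| < 0.0005 := by
  have h3 : (0 : ℝ) < √3 := by positivity
  have hlow : (1.7319 : ℝ) < √3 := Real.lt_sqrt_of_sq_lt (by norm_num)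
  have hhigh : √3 < (1.7321 : ℝ) := (Real.sqrt_lt' (by norm_num)).2 (by norm_num)
  have h1 : 2 / √3 < 1.1555 := by rw [div_lt_iff₀ h3]; linarith
  have h2 : 1.1545 < 2 / √3 := by rw [lt_div_iff₀ h3]; linarith
  rw [abs_lt]
  constructor <;> linarith

end Numerics

end Delegation

theorem mainTheorem5 {Ω : Type u} [MeasurableSpace Ω] (n : ℕ) (hn : 2 ≤ n)
    (x : Ω → ℝ) (hx : Measurable x) (hx_pos : ∀ w, 0 < x w) :
    (∃ M : Delegation.Mechanism n Ω,
      (∃ rank : Equiv.Perm (Fin n),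
        M = Delegation.singleProposal x (fun _ => Set.univ) rank) ∧
      ∀ (k : ℕ) (_ : 2 ≤ k) (P : Measure Ω) (_ : IsProbabilityMeasure P)
        (y : Fin n → Ω → ℝ) (_ : ∀ i w, 0 < y i w),
        (Delegation.HasMHR (P.map x) →
          MemLp id 2 (Delegation.bestLaw x k P) ∧
          M.HasAdditivePoA x y k P
            (√(4 / 3 * variance id (Delegation.bestLaw x k P)))) ∧
        (P.map x = volume.restrict (Set.Icc (0 : ℝ) 1) →
          √(4 / 3 * variance id (Delegation.bestLaw x k P)) =
            √(4 * (k : ℝ) / (3 * ((k : ℝ) + 1) ^ 2 * ((k : ℝ) + 2))) ∧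
          M.HasAdditivePoA x y k P
            (√(4 * (k : ℝ) / (3 * ((k : ℝ) + 1) ^ 2 * ((k : ℝ) + 2)))))) ∧
    (∀ k : ℕ, 2 ≤ k →
      √(4 * (k : ℝ) / (3 * ((k : ℝ) + 1) ^ 2 * ((k : ℝ) + 2))) ≤ 1.155 / (k : ℝ)) ∧
    Tendsto (fun k : ℕ =>
      (k : ℝ) * √(4 * (k : ℝ) / (3 * ((k : ℝ) + 1) ^ 2 * ((k : ℝ) + 2)))) atTop
      (𝓝 (2 / √3)) ∧
    |2 / √3 - (1.155 : ℝ)| < 0.0005 := by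
  -- The identity ranking; the bounds used hold for every ranking.
  refine ⟨⟨_, ⟨1, rfl⟩, fun k hk P _ y hy => ?_⟩,
    fun k hk => Delegation.sqrt_uniform_bound_le k (by omega),
    Delegation.tendsto_mul_sqrt_uniform_bound, Delegation.abs_two_div_sqrt_three_sub_lt⟩
  have hk1 : 1 ≤ k := by omega
  have key := fun h => Delegation.hasAdditivePoA_of_hasMHR (P := P) hx hx_pos hn 1 hk1 y hy h
  refine ⟨fun h => ⟨Delegation.memLp_two_bestLaw hx hx_pos hk1 h, key h⟩, fun h => ?_⟩
  have hmhr : Delegation.HasMHR (P.map x) := by rw [h]; exact Delegation.hasMHR_uniform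
  have := Delegation.isProbabilityMeasure_bestLaw (k := k) (P := P) hx
  have hcdf := Delegation.cdf_bestLaw (P := P) hx hk1
  rw [h] at hcdf
  have heq : 4 / 3 * variance id (Delegation.bestLaw x k P) =
      4 * (k : ℝ) / (3 * ((k : ℝ) + 1) ^ 2 * ((k : ℝ) + 2)) := by
    rw [Delegation.variance_of_cdf_eq_uniform_pow hk1 hcdf
      (Delegation.memLp_two_bestLaw hx hx_pos hk1 hmhr), div_mul_div_comm, mul_assoc 3]
  exact ⟨by rw [heq], heq ▸ key hmhr⟩
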